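/- **Conventions.** Let $\mathbb{Q}\langle\langle \mathbf{x}\rangle\rangle$ be the algebra of formal power series over $\mathbb{Q}$ in noncommuting variables $\mathbf{x}_1,\mathbf{x}_2,\ldots$, and $[n]=\{1,\dots,n\}$. A *set composition* $(\Phi_1|\cdots|\Phi_k)$ of a finite set $A$ is a list of mutually disjoint nonempty sets with union $A$. Let $\mathrm{NCQSym}$ be the subalgebra of those $f$ of bounded degree such that, for every set composition $\Phi$ of $[n]$, $n\ge 0$, all monomials $\mathbf{x}_{i_1}\cdots\mathbf{x}_{i_n}$ with $i_j=i_\ell$ whenever $j,\ell$ lie in the same block of $\Phi$, and $i_j<i_\ell$ whenever $j\in\Phi_p$, $\ell\in\Phi_q$, $p<q$, have the same coefficient in $f$. For any linearly ordered alphabet, $f\in \mathrm{NCQSym}$ is evaluated at that alphabet by giving each word the coefficient in $f$ of the words in $\mathbf{x}_1<\mathbf{x}_2<\cdots$ with the same pattern of equalities and inequalities between letters. The coproduct $\Delta f\in\mathrm{NCQSym}\otimes\mathrm{NCQSym}$ is the unique element $\sum f_1\otimes f_2$ such that $\sum f_1(\mathbf{x})f_2(\mathbf{y})$ is the series obtained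 from the evaluation $f(\mathbf{x},\mathbf{y})$ at the alphabet $\mathbf{x}_1<\mathbf{x}_2<\cdots<\mathbf{y}_1<\mathbf{y}_2<\cdots$ by imposing the relations $\mathbf{x}_i\mathbf{y}_j=\mathbf{y}_j\mathbf{x}_i$ for all $i,j$. Let $r$ be a positive integer. An *$r$-set-composition* $(\Phi,\Pi)$ of $[n]$ consists of a set composition $\Phi=(\Phi_1|\cdots|\Phi_k)$ of a subset $A\subseteq[n]$ all of whose blocks have at least $r$ elements and a set partition $\Pi$ of $[n]\setminus A$ all of whose blocks have fewer than $r$ elements. The *$r$-dominant monomial function* is $\mathbf{M}_{(\Phi,\Pi)}=\sum \mathbf{x}_{i_1}\cdots\mathbf{x}_{i_n}$, summed over all tuples $(i_1,\dots,i_n)$ of positive integers such that $i_j=i_\ell$ if and only if $j$ and $\ell$ are in the same block of either $\Phi$ or $\Pi$, and $i_j<i_\ell$ whenever $j\in\Phi_p$, $\ell\in\Phi_q$ with $p<q$. Let $\mathrm{NCQSym}^r\subseteq \mathrm{NCQSym}$ be the $\mathbb{Q}$-span of all $\mathbf{M}_{(\Phi,\Pi)}$, where $(\Phi,\Pi)$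 runs over the $r$-set-compositions of $[n]$, $n\ge0$. **Theorem.** For every positive integer $r$, $\mathrm{NCQSym}^r$ is a Hopf algebra with the product and coproduct of $\mathrm{NCQSym}$. That is, $\mathrm{NCQSym}^r$ is a unital subalgebra of $\mathrm{NCQSym}$, $\Delta(\mathrm{NCQSym}^r)\subseteq\mathrm{NCQSym}^r\otimes\mathrm{NCQSym}^r$, and with this product and coproduct $\mathrm{NCQSym}^r$ is a Hopf algebra over $\mathbb{Q}$ (that is, it has a counit and an antipode). -/

import Mathlib

open scoped TensorProduct

/-! ### Formal power series in noncommuting variables -/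

/-- Formal power series over `ℚ` in noncommuting variables indexed by `X`: a series is given by its
coefficient at every monomial `x_{i_1} ⋯ x_{i_n}`, i.e. at every word `[i_1, …, i_n]`. -/
def NCPowerSeries (X : Type) : Type := List X → ℚ

namespace NCPowerSeries

variable {X : Type}

instance : AddCommGroup (NCPowerSeries X) := inferInstanceAs (AddCommGroup (List X → ℚ))
instance : Module ℚ (NCPowerSeries X) := inferInstanceAs (Module ℚ (List X → ℚ))

/-- The coefficient of a series at a word. -/
def coeff (w : List X) : NCPowerSeries X →ₗ[ℚ] ℚ := LinearMap.proj w

@[ext] theorem ext {f g : NCPowerSeries X} (h : ∀ w, coeff w f = coeff w g) : f = g := funext h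

instance : One (NCPowerSeries X) := ⟨fun w => if w = [] then 1 else 0⟩

/-- The product of series: sum over all factorizations of a word as a concatenation. -/
instance : Mul (NCPowerSeries X) :=
  ⟨fun f g w => ∑ k ∈ Finset.range (w.length + 1), coeff (w.take k) f * coeff (w.drop k) g⟩

theorem coeff_one (w : List X) : coeff w (1 : NCPowerSeries X) = if w = [] then 1 else 0 := rfl

theorem coeff_mul (w : List X) (f g : NCPowerSeries X) : coeff w (f * g) =
    ∑ k ∈ Finset.range (w.length + 1), coeff (w.take k) f * coeff (w.drop k) g := rfl

theorem coeff_nil_mul (f g : NCPowerSeries X) :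
    coeff [] (f * g) = coeff [] f * coeff [] g := by
  simp [coeff_mul]

/-- Left division of a series by a letter (only used to prove the ring axioms). -/
def shift (a : X) : NCPowerSeries X →ₗ[ℚ] NCPowerSeries X := LinearMap.pi fun w => coeff (a :: w)

theorem coeff_shift (a : X) (w : List X) (f : NCPowerSeries X) :
    coeff w (shift a f) = coeff (a :: w) f := rfl

theorem coeff_cons_mul (a : X) (w : List X) (f g : NCPowerSeries X) :
    coeff (a :: w) (f * g) = coeff [] f * coeff (a :: w) g + coeff w (shift a f * g) := by
  rw [coeff_mul, List.length_cons, Finset.sum_range_succ', coeff_mul, add_comm]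
  rfl

protected theorem add_mul (f g h : NCPowerSeries X) : (f + g) * h = f * h + g * h := by
  ext w
  simp [coeff_mul, add_mul, Finset.sum_add_distrib]

protected theorem mul_add (f g h : NCPowerSeries X) : f * (g + h) = f * g + f * h := by
  ext w
  simp [coeff_mul, mul_add, Finset.sum_add_distrib]

protected theorem smul_mul (c : ℚ) (f g : NCPowerSeries X) : (c • f) * g = c • (f * g) := by
  ext w
  simp [coeff_mul, Finset.mul_sum, mul_assoc]

protected theorem mul_smul (c : ℚ) (f g : NCPowerSeries X) : f * (c • g) = c • (f * g) := by
  ext w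
  simp [coeff_mul, Finset.mul_sum, mul_left_comm]

theorem shift_mul (a : X) (f g : NCPowerSeries X) :
    shift a (f * g) = coeff [] f • shift a g + shift a f * g := by
  ext w
  simp [coeff_shift, coeff_cons_mul]

protected theorem mul_assoc (f g h : NCPowerSeries X) : f * g * h = f * (g * h) := by
  ext w
  induction w generalizing f g h with
  | nil => simp [coeff_nil_mul, mul_assoc]
  | cons a w ih =>
    rw [coeff_cons_mul, coeff_cons_mul, coeff_cons_mul, shift_mul, NCPowerSeries.add_mul,
      NCPowerSeries.smul_mul, map_add, map_smul, ih, coeff_nil_mul, smul_eq_mul]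
    ring

protected theorem one_mul (f : NCPowerSeries X) : 1 * f = f := by
  ext w
  cases w with
  | nil => simp [coeff_nil_mul, coeff_one]
  | cons a w =>
    have : shift a (1 : NCPowerSeries X) = 0 := by
      ext v
      simp [coeff_shift, coeff_one]
    rw [coeff_cons_mul, this, ← zero_smul ℚ (0 : NCPowerSeries X), NCPowerSeries.smul_mul]
    simp [coeff_one]

protected theorem mul_one (f : NCPowerSeries X) : f * 1 = f := by
  ext w
  induction w generalizing f with
  | nil => simp [coeff_nil_mul, coeff_one]
  | cons a w ih =>
    rw [coeff_cons_mul, ih, coeff_shift]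
    simp [coeff_one]

instance : Ring (NCPowerSeries X) :=
  { (inferInstance : AddCommGroup (NCPowerSeries X)) with
    mul := (· * ·)
    one := 1
    mul_assoc := NCPowerSeries.mul_assoc
    one_mul := NCPowerSeries.one_mul
    mul_one := NCPowerSeries.mul_one
    left_distrib := NCPowerSeries.mul_add
    right_distrib := NCPowerSeries.add_mul
    zero_mul := fun f => by
      rw [← zero_smul ℚ (0 : NCPowerSeries X), NCPowerSeries.smul_mul, zero_smul, zero_smul]
    mul_zero := fun f => by
      rw [← zero_smul ℚ (0 : NCPowerSeries X), NCPowerSeries.mul_smul, zero_smul, zero_smul] }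

instance : Algebra ℚ (NCPowerSeries X) :=
  Algebra.ofModule NCPowerSeries.smul_mul (fun c f g => NCPowerSeries.mul_smul c f g)

end NCPowerSeries

/-! ### Set compositions and `r`-set-compositions -/

/-- A set composition of a finite set `A`: a list of mutually disjoint nonempty sets with
union `A`. -/
structure SetComposition {α : Type} (A : Finset α) where
  blocks : List (Finset α)
  nonempty : ∀ B ∈ blocks, B.Nonempty
  disjoint : blocks.Pairwise Disjoint
  mem_iff : ∀ a, a ∈ A ↔ ∃ B ∈ blocks, a ∈ B

/-- An index tuple `i` satisfies the conditions imposed by a set composition `Φ` of the set of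
positions: it is constant on the blocks of `Φ`, and it strictly increases from each block to each
later block. -/
def SetComposition.Compatible {n : ℕ} {X : Type} [LinearOrder X]
    (Φ : SetComposition (Finset.univ : Finset (Fin n))) (i : Fin n → X) : Prop :=
  (∀ B ∈ Φ.blocks, ∀ j ∈ B, ∀ k ∈ B, i j = i k) ∧
    Φ.blocks.Pairwise fun B C => ∀ j ∈ B, ∀ k ∈ C, i j < i k

/-- An `r`-set-composition `(Φ, Π)` of the `n`-element set `Fin n` of positions: `Φ` is a set
composition of a subset, all of whose blocks have at least `r` elements, and `Π` is a set partition
of the complement, all of whose blocks have fewer than `r` elements. -/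
structure RSetComposition (r n : ℕ) where
  support : Finset (Fin n)
  comp : SetComposition support
  part : Finpartition (Finset.univ \ support)
  le_card : ∀ B ∈ comp.blocks, r ≤ B.card
  card_lt : ∀ B ∈ part.parts, B.card < r

/-- The conditions on the index tuples that occur in `M_(Φ,Π)`: two indices are equal if and only if
their positions lie in the same block of `Φ` or of `Π`, and indices strictly increase from each
block of `Φ` to each later block of `Φ`. -/
def RSetComposition.Compatible {r n : ℕ} {X : Type} [LinearOrder X] (Φ : RSetComposition r n)
    (i : Fin n → X) : Prop :=
  (∀ j k, i j = i k ↔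
    (∃ B ∈ Φ.comp.blocks, j ∈ B ∧ k ∈ B) ∨ (∃ B ∈ Φ.part.parts, j ∈ B ∧ k ∈ B)) ∧
    Φ.comp.blocks.Pairwise fun B C => ∀ j ∈ B, ∀ k ∈ C, i j < i k

theorem RSetComposition.Compatible.of_lt_iff {r n : ℕ} {X Y : Type} [LinearOrder X] [LinearOrder Y]
    {Φ : RSetComposition r n} {i : Fin n → X} {i' : Fin n → Y} (h : Φ.Compatible i)
    (hi : ∀ j k, i j < i k ↔ i' j < i' k) : Φ.Compatible i' := by
  refine ⟨fun j k => ?_, h.2.imp fun H j hj k hk => (hi j k).1 (H j hj k hk)⟩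
  rw [← h.1 j k, le_antisymm_iff, le_antisymm_iff, ← not_lt, ← not_lt, ← not_lt, ← not_lt,
    hi, hi]

namespace SetComposition

variable {n : ℕ} {X Y : Type} [LinearOrder X] [LinearOrder Y]

theorem Compatible.lt_iff {Φ : SetComposition (Finset.univ : Finset (Fin n))} {i : Fin n → X}
    {i' : Fin n → Y} (h : Φ.Compatible i) (h' : Φ.Compatible i') (j k : Fin n) :
    i j < i k ↔ i' j < i' k := by
  obtain ⟨B, hB, hj⟩ := (Φ.mem_iff j).1 (Finset.mem_univ j)
  obtain ⟨C, hC, hk⟩ := (Φ.mem_iff k).1 (Finset.mem_univ k)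
  obtain ⟨b, rfl⟩ := List.mem_iff_get.1 hB
  obtain ⟨c, rfl⟩ := List.mem_iff_get.1 hC
  rcases lt_trichotomy b c with hbc | rfl | hbc
  · exact iff_of_true (List.pairwise_iff_get.1 h.2 b c hbc j hj k hk)
      (List.pairwise_iff_get.1 h'.2 b c hbc j hj k hk)
  · rw [h.1 _ hB j hj k hk, h'.1 _ hB j hj k hk]
    simp
  · exact iff_of_false (List.pairwise_iff_get.1 h.2 c b hbc k hk j hj).not_gt
      (List.pairwise_iff_get.1 h'.2 c b hbc k hk j hj).not_gt

theorem Compatible.of_lt_iff {Φ : SetComposition (Finset.univ : Finset (Fin n))} {i : Fin n → X}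
    {i' : Fin n → Y} (h : Φ.Compatible i) (hi : ∀ j k, i j < i k ↔ i' j < i' k) :
    Φ.Compatible i' := by
  refine ⟨fun B hB j hj k hk => ?_, h.2.imp fun H j hj k hk => (hi j k).1 (H j hj k hk)⟩
  have e := h.1 B hB j hj k hk
  refine le_antisymm (not_lt.1 fun hlt => ?_) (not_lt.1 fun hlt => ?_)
  · exact ((hi k j).2 hlt).ne e.symm
  · exact ((hi j k).2 hlt).ne e

/-- The set composition of positions given by the level sets of an index tuple, in increasing order
of the index. -/
def ofTuple (i : Fin n → X) : SetComposition (Finset.univ : Finset (Fin n)) where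
  blocks := ((Finset.univ.image i).sort (· ≤ ·)).map fun a => Finset.univ.filter fun j => i j = a
  nonempty := by
    intro B hB
    obtain ⟨a, ha, rfl⟩ := List.mem_map.1 hB
    obtain ⟨j, -, rfl⟩ := Finset.mem_image.1 ((Finset.mem_sort _).1 ha)
    exact ⟨j, by simp⟩
  disjoint := by
    rw [List.pairwise_map]
    refine (Finset.sort_nodup _ _).imp fun {a b} hab => ?_
    rw [Finset.disjoint_left]
    intro j hj hj'
    simp only [Finset.mem_filter, Finset.mem_univ, true_and] at hj hj'
    exact hab (hj.symm.trans hj')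
  mem_iff := by
    intro j
    simp

theorem compatible_ofTuple (i : Fin n → X) : (ofTuple i).Compatible i := by
  refine ⟨fun B hB j hj k hk => ?_, ?_⟩
  · obtain ⟨a, -, rfl⟩ := List.mem_map.1 hB
    simp only [Finset.mem_filter, Finset.mem_univ, true_and] at hj hk
    rw [hj, hk]
  · unfold ofTuple
    rw [List.pairwise_map]
    refine (Finset.sortedLT_sort _).pairwise.imp fun {a b} hab j hj k hk => ?_
    simp only [Finset.mem_filter, Finset.mem_univ, true_and] at hj hk
    rwa [hj, hk]

end SetComposition

/-! ### Quasisymmetric functions in noncommuting variables -/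

/-- A series is quasisymmetric if its degrees are bounded and, for every set composition `Φ` of the
set of positions, all monomials whose index tuple is compatible with `Φ` have the same
coefficient. -/
def IsNCQuasisymmetric {X : Type} [LinearOrder X] (f : NCPowerSeries X) : Prop :=
  (∃ d : ℕ, ∀ w : List X, d < w.length → f.coeff w = 0) ∧
    ∀ (n : ℕ) (Φ : SetComposition (Finset.univ : Finset (Fin n))) (i i' : Fin n → X),
      Φ.Compatible i → Φ.Compatible i' → f.coeff (List.ofFn i) = f.coeff (List.ofFn i')

theorem IsNCQuasisymmetric.coeff_eq {X : Type} [LinearOrder X] {f : NCPowerSeries X}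
    (hf : IsNCQuasisymmetric f) {n : ℕ} {i i' : Fin n → X} (h : ∀ j k, i j < i k ↔ i' j < i' k) :
    f.coeff (List.ofFn i) = f.coeff (List.ofFn i') :=
  hf.2 n (SetComposition.ofTuple i) i i' (SetComposition.compatible_ofTuple i)
    ((SetComposition.compatible_ofTuple i).of_lt_iff h)

theorem ofFn_take_drop {X : Type} {n k : ℕ} (hk : k ≤ n) (i : Fin n → X) :
    (List.ofFn i).take k = List.ofFn (fun j : Fin k => i (Fin.castLE hk j)) ∧
    (List.ofFn i).drop k =
      List.ofFn (fun j : Fin (n - k) => i ⟨k + j, by omega⟩) := by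
  constructor
  · apply List.ext_getElem <;> simp [hk]
  · apply List.ext_getElem <;> simp

/-- The algebra `NCQSym` of quasisymmetric functions in noncommuting variables indexed by a linear
order `X`. -/
def NCQSym (X : Type) [LinearOrder X] : Subalgebra ℚ (NCPowerSeries X) where
  carrier := {f | IsNCQuasisymmetric f}
  mul_mem' := by
    rintro f g hf hg
    obtain ⟨d, hd⟩ := hf.1
    obtain ⟨e, he⟩ := hg.1
    refine ⟨⟨d + e, fun w hw => ?_⟩, fun n Φ i i' hi hi' => ?_⟩
    · rw [NCPowerSeries.coeff_mul]
      refine Finset.sum_eq_zero fun k hk => ?_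
      have hk' : k ≤ w.length := Nat.lt_succ_iff.1 (Finset.mem_range.1 hk)
      by_cases h : d < k
      · rw [hd _ (by simpa [hk'] using h), zero_mul]
      · rw [he (w.drop k) (by rw [List.length_drop]; omega), mul_zero]
    · rw [NCPowerSeries.coeff_mul, NCPowerSeries.coeff_mul, List.length_ofFn, List.length_ofFn]
      refine Finset.sum_congr rfl fun k hk => ?_
      have hk' : k ≤ n := Nat.lt_succ_iff.1 (Finset.mem_range.1 hk)
      rw [(ofFn_take_drop hk' i).1, (ofFn_take_drop hk' i).2,
        (ofFn_take_drop hk' i').1, (ofFn_take_drop hk' i').2]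
      rw [hf.coeff_eq (fun a b => hi.lt_iff hi' _ _), hg.coeff_eq (fun a b => hi.lt_iff hi' _ _)]
  add_mem' := by
    rintro f g hf hg
    obtain ⟨d, hd⟩ := hf.1
    obtain ⟨e, he⟩ := hg.1
    refine ⟨⟨max d e, fun w hw => ?_⟩, fun n Φ i i' hi hi' => ?_⟩
    · rw [map_add, hd w (by omega), he w (by omega), add_zero]
    · rw [map_add, map_add, hf.2 n Φ i i' hi hi', hg.2 n Φ i i' hi hi']
  algebraMap_mem' := by
    intro c
    rw [Algebra.algebraMap_eq_smul_one]
    refine ⟨⟨0, fun w hw => ?_⟩, fun n Φ i i' hi hi' => ?_⟩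
    · rw [map_smul, NCPowerSeries.coeff_one, if_neg (List.length_pos_iff.1 hw), smul_zero]
    · rw [map_smul, map_smul, NCPowerSeries.coeff_one, NCPowerSeries.coeff_one]
      simp only [List.ofFn_eq_nil_iff]

theorem ofFn_getElem_self {X : Type} (w : List X) :
    List.ofFn (fun j : Fin w.length => w[j]) = w := List.ofFn_getElem

/-! ### The coproduct of `NCQSym` -/

/-- The rank, starting from `1`, of `a` among the distinct letters of the word `w`. -/
def letterRank {Y : Type} [LinearOrder Y] (w : List Y) (a : Y) : ℕ+ :=
  Nat.succPNat (w.toFinset.filter (· < a)).card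

theorem letterRank_lt_iff {Y : Type} [LinearOrder Y] {w : List Y} {a b : Y} (ha : a ∈ w)
    (hb : b ∈ w) : letterRank w a < letterRank w b ↔ a < b := by
  have key : ∀ {a b : Y}, a ∈ w → a < b → letterRank w a < letterRank w b := by
    intro a b ha hab
    refine Nat.succPNat_lt_succPNat.2 (Finset.card_lt_card ?_)
    refine Finset.ssubset_iff_subset_ne.2 ⟨fun c hc => ?_, fun h => ?_⟩
    · rw [Finset.mem_filter] at hc ⊢
      exact ⟨hc.1, hc.2.trans hab⟩
    · have : a ∈ w.toFinset.filter (· < a) := by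
        rw [h, Finset.mem_filter]
        exact ⟨List.mem_toFinset.2 ha, hab⟩
      exact lt_irrefl a (Finset.mem_filter.1 this).2
  refine ⟨fun h => ?_, key ha⟩
  rcases lt_trichotomy a b with h' | rfl | h'
  · exact h'
  · exact absurd h (lt_irrefl _)
  · exact absurd h (key hb h').not_gt

/-- Evaluation of `f ∈ NCQSym(x_1 < x_2 < ⋯)` at another linearly ordered alphabet `Y`: the
coefficient at a word `w` in `Y` is the coefficient of `f` at the word in the positive integers with
the same relative order of letters. -/
def NCQSym.eval {Y : Type} [LinearOrder Y] (f : NCQSym ℕ+) : NCQSym Y where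
  val := fun w => f.1.coeff (w.map (letterRank w))
  property := by
    obtain ⟨f, hf⟩ := f
    obtain ⟨d, hd⟩ := hf.1
    refine ⟨⟨d, fun w hw => hd _ (by simpa using hw)⟩, fun n Φ i i' hi hi' => ?_⟩
    change f.coeff ((List.ofFn i).map _) = f.coeff ((List.ofFn i').map _)
    rw [List.map_ofFn, List.map_ofFn]
    refine hf.coeff_eq fun j k => ?_
    simp only [Function.comp]
    rw [letterRank_lt_iff (by simp) (by simp), letterRank_lt_iff (by simp) (by simp),
      hi.lt_iff hi']

theorem NCQSym.coeff_eval {Y : Type} [LinearOrder Y] (f : NCQSym ℕ+) (w : List Y) :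
    (NCQSym.eval f : NCQSym Y).1.coeff w = f.1.coeff (w.map (letterRank w)) := rfl

/-- On the original alphabet, evaluation is the identity. -/
theorem NCQSym.eval_self (f : NCQSym ℕ+) : (NCQSym.eval f : NCQSym ℕ+) = f := by
  obtain ⟨f, hf⟩ := f
  refine Subtype.ext (NCPowerSeries.ext fun w => ?_)
  rw [NCQSym.coeff_eval]
  conv_rhs => rw [← ofFn_getElem_self w]
  have : w.map (letterRank w) = List.ofFn (fun j : Fin w.length => letterRank w w[j]) := by
    apply List.ext_getElem <;> simp
  rw [this]
  exact hf.coeff_eq fun j k => letterRank_lt_iff (by simp) (by simp)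

/-- The words in the alphabet `x_1 < x_2 < ⋯ < y_1 < y_2 < ⋯` which are shuffles of a word `u` in
the letters `x` and a word `v` in the letters `y`; see `mem_shuffles`. -/
def shuffles {X Y : Type} [DecidableEq X] [DecidableEq Y] :
    List X → List Y → Finset (List (X ⊕ₗ Y))
  | [], v => {v.map Sum.inrₗ}
  | a :: u, [] => {(a :: u).map Sum.inlₗ}
  | a :: u, b :: v =>
    (shuffles u (b :: v)).image (List.cons (Sum.inlₗ a)) ∪
      (shuffles (a :: u) v).image (List.cons (Sum.inrₗ b))

/-- `w` is a shuffle of `u` and `v` if and only if imposing the relations `x_i y_j = y_j x_i`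
identifies the monomial `w` with `u v`, i.e. `u` and `v` are the subwords of `w` formed by its
letters `x` and by its letters `y`. -/
theorem mem_shuffles {X Y : Type} [DecidableEq X] [DecidableEq Y] (u : List X) (v : List Y)
    (w : List (X ⊕ₗ Y)) : w ∈ shuffles u v ↔
      w.filterMap (fun z => (ofLex z).getLeft?) = u ∧
        w.filterMap (fun z => (ofLex z).getRight?) = v := by
  induction w generalizing u v with
  | nil => cases u <;> cases v <;> simp [shuffles]
  | cons z w ih =>
    obtain ⟨x | y, rfl⟩ := toLex.surjective z
    · have : toLex (Sum.inl x) :: w ∈ shuffles u v ↔ ∃ u', u = x :: u' ∧ w ∈ shuffles u' v := by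
        rcases u with _ | ⟨a, u⟩ <;> rcases v with _ | ⟨b, v⟩
        · simp [shuffles]
        · simp [shuffles, Sum.inrₗ]
        · cases u <;> simp [shuffles, Sum.inlₗ, @eq_comm _ a x]
        · simp [shuffles, Sum.inlₗ, Sum.inrₗ, and_comm]
      rw [this]
      simp only [ih, List.filterMap_cons, ofLex_toLex, Sum.getLeft?_inl, Sum.getRight?_inl]
      grind
    · have : toLex (Sum.inr y) :: w ∈ shuffles u v ↔ ∃ v', v = y :: v' ∧ w ∈ shuffles u v' := by
        rcases u with _ | ⟨a, u⟩ <;> rcases v with _ | ⟨b, v⟩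
        · simp [shuffles]
        · simp [shuffles, Sum.inrₗ, @eq_comm _ b y]
        · simp [shuffles, Sum.inlₗ]
        · simp [shuffles, Sum.inlₗ, Sum.inrₗ, and_comm]
      rw [this]
      simp only [ih, List.filterMap_cons, ofLex_toLex, Sum.getLeft?_inr, Sum.getRight?_inr]
      grind

/-- The coefficient at the partially commutative monomial `u v` of the series `f̄(x, y)`, obtained
from `f(x, y)` by imposing the relations `x_i y_j = y_j x_i`. -/
def NCQSym.coeffBar (f : NCQSym ℕ+) (u v : List ℕ+) : ℚ :=
  ∑ w ∈ shuffles u v, (NCQSym.eval f : NCQSym (ℕ+ ⊕ₗ ℕ+)).1.coeff w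

/-- The coefficient at the partially commutative monomial `u v` of the series in `x` and `y` that
corresponds to an element of `NCQSym(x) ⊗ NCQSym(y)`; here `f ⊗ g` corresponds to `f(x) g(y)`. -/
noncomputable def NCQSym.coeffTensor (u v : List ℕ+) : NCQSym ℕ+ ⊗[ℚ] NCQSym ℕ+ →ₗ[ℚ] ℚ :=
  LinearMap.mul' ℚ ℚ ∘ₗ TensorProduct.map
    (NCPowerSeries.coeff u ∘ₗ (NCQSym ℕ+).val.toLinearMap)
    (NCPowerSeries.coeff v ∘ₗ (NCQSym ℕ+).val.toLinearMap)

/-- `t` is the coproduct `Δ f` of `f` in `NCQSym`: the series in `x` and `y` corresponding to `t` is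
`f̄(x, y)`. This determines `t`, see `NCQSym.IsCoproduct.unique`. -/
def NCQSym.IsCoproduct (f : NCQSym ℕ+) (t : NCQSym ℕ+ ⊗[ℚ] NCQSym ℕ+) : Prop :=
  ∀ u v : List ℕ+, NCQSym.coeffTensor u v t = NCQSym.coeffBar f u v

theorem NCQSym.IsCoproduct.unique {f : NCQSym ℕ+} {t t' : NCQSym ℕ+ ⊗[ℚ] NCQSym ℕ+}
    (h : NCQSym.IsCoproduct f t) (h' : NCQSym.IsCoproduct f t') : t = t' := by
  classical
  let B := Module.Basis.ofVectorSpace ℚ (NCQSym ℕ+)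
  let E := TensorProduct.equivFinsuppOfBasisLeft (N := NCQSym ℕ+) B
  have key : ∀ (s : NCQSym ℕ+ ⊗[ℚ] NCQSym ℕ+) (u v : List ℕ+), NCQSym.coeffTensor u v s =
      NCPowerSeries.coeff u (((E s).sum fun b g => g.1.coeff v • B b : NCQSym ℕ+) :
        NCPowerSeries ℕ+) := by
    intro s u v
    conv_lhs => rw [← E.symm_apply_apply s]
    rw [TensorProduct.equivFinsuppOfBasisLeft_symm_apply]
    simp [Finsupp.sum, NCQSym.coeffTensor, mul_comm]
  refine E.injective (sub_eq_zero.1 ?_)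
  rw [← map_sub]
  ext1 b
  refine Subtype.ext (NCPowerSeries.ext fun v => ?_)
  have hz : ((E (t - t')).sum fun b g => g.1.coeff v • B b : NCQSym ℕ+) = 0 := by
    refine Subtype.ext (NCPowerSeries.ext fun u => ?_)
    rw [← key, map_sub, h u v, h' u v, sub_self]
    simp
  have hli := B.linearIndependent
  rw [linearIndependent_iff'] at hli
  by_cases hb : b ∈ (E (t - t')).support
  · simpa using hli _ _ hz b hb
  · rw [Finsupp.notMem_support_iff.1 hb]
    simp

/-! ### `r`-quasisymmetric functions in noncommuting variables -/

open Classical in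
/-- The `r`-dominant monomial function `M_(Φ,Π)`: the sum of all `x_{i_1} ⋯ x_{i_n}` over the index
tuples `i` compatible with `(Φ, Π)`. -/
noncomputable def rDominantMonomial {r n : ℕ} (Φ : RSetComposition r n) : NCQSym ℕ+ where
  val := fun w => if ∃ i : Fin n → ℕ+, Φ.Compatible i ∧ w = List.ofFn i then 1 else 0
  property := by
    refine ⟨⟨n, fun w hw => if_neg ?_⟩, fun m Ψ i i' hi hi' => ?_⟩
    · rintro ⟨i, -, rfl⟩
      simp at hw
    · have key : ∀ j j' : Fin m → ℕ+, Ψ.Compatible j → Ψ.Compatible j' →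
          (∃ i : Fin n → ℕ+, Φ.Compatible i ∧ List.ofFn j = List.ofFn i) →
          ∃ i : Fin n → ℕ+, Φ.Compatible i ∧ List.ofFn j' = List.ofFn i := by
        rintro j j' hj hj' ⟨i, hi, e⟩
        obtain rfl : m = n := by simpa using congrArg List.length e
        obtain rfl := List.ofFn_injective e
        exact ⟨j', hi.of_lt_iff fun a b => hj.lt_iff hj' a b, rfl⟩
      exact if_congr ⟨key i i' hi hi', key i' i hi' hi⟩ rfl rfl

/-- The homogeneous component `NCQSym^r_n`. -/
noncomputable def NCQSymRDegree (r n : ℕ) : Submodule ℚ (NCQSym ℕ+) :=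
  Submodule.span ℚ (Set.range fun Φ : RSetComposition r n => rDominantMonomial Φ)

/-- The space `NCQSym^r` of `r`-quasisymmetric functions in noncommuting variables. -/
noncomputable def NCQSymR (r : ℕ) : Submodule ℚ (NCQSym ℕ+) := ⨆ n : ℕ, NCQSymRDegree r n

/-- The linear space underlying the Hopf algebra `H` sits inside `NCQSym` via `ι`, in such a way that
the algebra structure of `H` is that of `NCQSym` and the coproduct of `H` is that of `NCQSym`. -/
def InheritsFromNCQSym {H : Type} [Semiring H] [HopfAlgebra ℚ H] (ι : H → NCQSym ℕ+) : Prop :=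
  Function.Injective ι ∧ ∃ φ : H →ₐ[ℚ] NCQSym ℕ+, ⇑φ = ι ∧
    ∀ h : H, NCQSym.IsCoproduct (ι h)
      (TensorProduct.map φ.toLinearMap φ.toLinearMap (Coalgebra.comul (R := ℚ) h))

/-! Call two words similar when they have the same equalities between letters and the same relative
order among the letters occurring at least `r` times (`RSimilar`). The dominant monomial functions
are the indicator functions of the similarity classes, and each length has finitely many classes.
Hence `NCQSymR r` consists of the elements of `NCQSym` whose coefficients are constant on similarity
classes (`IsRInvariant`, `toSubmodule_NCQSymRSubalgebra`), and closure can be checked on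
coefficients.

Products: a letter frequent in a factor of a word is frequent in the word, so cutting similar words
at the same place gives similar pieces. Coproducts: the coefficient at `u ⊗ v` is a sum over the
shuffles of `u` and `v`. Since every `x` precedes every `y`, replacing `u` and `v` by similar words
replaces each shuffle by a similar one (`RSimilar.sum_append`, `NCQSym.shuffleCoeff_map_eq`). The
coefficient is therefore invariant in `u` and in `v` separately, and expanding it in `u` gives a
finite sum of tensors of invariant series (`exists_coproduct`).

Coefficient functionals separate tensors, so the bialgebra axioms become identities of shuffle sums:
coassociativity is associativity of shuffling (`shuffleSum_assoc`), and multiplicativity says that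
cutting a shuffle gives a shuffle of prefixes and a shuffle of suffixes (`shuffleSum_mul`). Finally,
the degree filtration starts with the scalars, so unit∘counit minus the identity is locally
nilpotent for convolution, and a geometric series gives the antipode. -/

/-! ### Antipodes of filtered bialgebras -/

section FilteredBialgebra

open WithConv Coalgebra

variable {R H : Type} [CommRing R] [Ring H] [Bialgebra R H]

/-- The linear span of the tensors `a ⊗ b` with `a ∈ F i`, `b ∈ F j`, `i + j = n`. -/
def tensorFiltration {R H : Type} [CommRing R] [AddCommGroup H] [Module R H]
    (F : ℕ → Submodule R H) (n : ℕ) : Submodule R (H ⊗[R] H) :=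
  Submodule.span R {t | ∃ i j, i + j = n ∧ ∃ a ∈ F i, ∃ b ∈ F j, t = a ⊗ₜ[R] b}

theorem eqOn_tensorFiltration {F : ℕ → Submodule R H} {n : ℕ} {M : Type} [AddCommGroup M]
    [Module R M] {f g : H ⊗[R] H →ₗ[R] M}
    (h : ∀ i j, i + j = n → ∀ a ∈ F i, ∀ b ∈ F j, f (a ⊗ₜ b) = g (a ⊗ₜ b)) {t : H ⊗[R] H}
    (ht : t ∈ tensorFiltration F n) : f t = g t := by
  refine LinearMap.eqOn_span (f := f) (g := g) ?_ ht
  rintro _ ⟨i, j, hij, a, ha, b, hb, rfl⟩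
  exact h i j hij a ha b hb

/-- Peeling off one convolution factor leaves products of values at `a ∈ F i` and `b ∈ F j` with `i
+ j = n`. For `i = 0` the factor `1 - id` kills `a`; for `i > 0` one has `j < k`, and induction
kills `b`. -/
theorem convPow_id_sub_one_apply_eq_zero {F : ℕ → Submodule R H}
    (h0 : ∀ x ∈ F 0, algebraMap R H (counit x) = x)
    (hF : ∀ n, ∀ x ∈ F n, comul x ∈ tensorFiltration F n) (k : ℕ) :
    ∀ n < k, ∀ x ∈ F n, ((1 - toConv LinearMap.id : WithConv (H →ₗ[R] H)) ^ k) x = 0 := by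
  induction k with
  | zero => intro n hn; omega
  | succ k ih =>
    intro n hn x hx
    rw [pow_succ', LinearMap.convMul_apply]
    have := eqOn_tensorFiltration (f := LinearMap.mul' R H ∘ₗ TensorProduct.map
      (1 - toConv LinearMap.id : WithConv (H →ₗ[R] H)).ofConv
      ((1 - toConv LinearMap.id : WithConv (H →ₗ[R] H)) ^ k).ofConv) (g := 0) ?_ (hF n x hx)
    · simpa using this
    · intro i j hij a ha b hb
      rcases Nat.eq_zero_or_pos i with rfl | hi
      · have : (1 - toConv LinearMap.id : WithConv (H →ₗ[R] H)).ofConv a = 0 :=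
          sub_eq_zero.2 (h0 a ha)
        simp only [LinearMap.comp_apply, TensorProduct.map_tmul, this, LinearMap.mul'_apply, zero_mul,
          LinearMap.zero_apply]
      · have : ((1 - toConv LinearMap.id : WithConv (H →ₗ[R] H)) ^ k).ofConv b = 0 :=
          ih j (by omega) b hb
        simp [this]

/-- A bialgebra with an exhaustive filtration which is compatible with the coproduct and starts with
the scalars has an antipode. -/
theorem exists_hopfAlgebra_of_filtration (F : ℕ → Submodule R H) (hcover : ∀ x, ∃ n, x ∈ F n)
    (h0 : ∀ x ∈ F 0, algebraMap R H (counit x) = x)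
    (hF : ∀ n, ∀ x ∈ F n, comul x ∈ tensorFiltration F n) :
    ∃ K : HopfAlgebra R H, K.toBialgebra = ‹Bialgebra R H› := by
  let J : WithConv (H →ₗ[R] H) := 1 - toConv LinearMap.id
  have hJ : ∀ k, ∀ n < k, ∀ x ∈ F n, (J ^ k) x = 0 := convPow_id_sub_one_apply_eq_zero h0 hF
  have hfin : ∀ x, (Function.support fun k => (J ^ k) x).Finite := by
    intro x
    obtain ⟨n, hn⟩ := hcover x
    refine (Set.finite_Iic n).subset fun k hk => ?_
    by_contra h
    exact hk (hJ k n (by simpa using h) x hn)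
  -- The geometric series inverting `id = 1 - J` for convolution; at each `x` only finitely many
  -- terms survive.
  let S : H →ₗ[R] H :=
    { toFun := fun x => ∑ᶠ k, (J ^ k) x
      map_add' := fun x y => by
        rw [← finsum_add_distrib (hfin x) (hfin y)]
        exact finsum_congr fun k => map_add (J ^ k).ofConv x y
      map_smul' := fun c x => by
        rw [RingHom.id_apply, smul_finsum' c (hfin x)]
        exact finsum_congr fun k => map_smul (J ^ k).ofConv c x }
  let T : ℕ → WithConv (H →ₗ[R] H) := fun N => ∑ k ∈ Finset.range N, J ^ k
  have hT : ∀ N x, (T N).ofConv x = ∑ k ∈ Finset.range N, (J ^ k) x := by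
    intro N x
    simp only [T, WithConv.ofConv_sum, LinearMap.sum_apply]
  have hS : ∀ n, ∀ x ∈ F n, ∀ N, n < N → S x = (T N).ofConv x := by
    intro n x hx N hN
    rw [hT]
    refine finsum_eq_sum_of_support_subset _ fun k hk => ?_
    by_contra h
    exact hk (hJ k n (by simp at h; omega) x hx)
  have hid : toConv LinearMap.id = 1 - J := by simp [J]
  refine ⟨HopfAlgebra.ofConvInverse S ?_ ?_, rfl⟩
  · ext x
    obtain ⟨n, hn⟩ := hcover x
    -- The coproduct of `x` only involves `F i` with `i ≤ n`, where `S` is the partial sum `T (n +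
    -- 1)`. That sum telescopes to `1 - J ^ (n + 1)`, whose second term kills `F n`.
    have h1 : (toConv S * toConv LinearMap.id : WithConv (H →ₗ[R] H)) x =
        (T (n + 1) * toConv LinearMap.id : WithConv (H →ₗ[R] H)) x := by
      rw [LinearMap.convMul_apply, LinearMap.convMul_apply]
      refine eqOn_tensorFiltration (f := LinearMap.mul' R H ∘ₗ TensorProduct.map S LinearMap.id)
        (g := LinearMap.mul' R H ∘ₗ TensorProduct.map (T (n + 1)).ofConv LinearMap.id) ?_ (hF n x hn)
      intro i j hij a ha b hb
      simp [hS i a ha (n + 1) (by omega)]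
    rw [h1, hid, geom_sum_mul_neg]
    change (1 : WithConv (H →ₗ[R] H)) x - (J ^ (n + 1)) x = _
    rw [hJ (n + 1) n (by omega) x hn, sub_zero]
  · ext x
    obtain ⟨n, hn⟩ := hcover x
    have h1 : (toConv LinearMap.id * toConv S : WithConv (H →ₗ[R] H)) x =
        (toConv LinearMap.id * T (n + 1) : WithConv (H →ₗ[R] H)) x := by
      rw [LinearMap.convMul_apply, LinearMap.convMul_apply]
      refine eqOn_tensorFiltration (f := LinearMap.mul' R H ∘ₗ TensorProduct.map LinearMap.id S)
        (g := LinearMap.mul' R H ∘ₗ TensorProduct.map LinearMap.id (T (n + 1)).ofConv) ?_ (hF n x hn)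
      intro i j hij a ha b hb
      simp [hS j b hb (n + 1) (by omega)]
    rw [h1, hid, mul_neg_geom_sum]
    change (1 : WithConv (H →ₗ[R] H)) x - (J ^ (n + 1)) x = _
    rw [hJ (n + 1) n (by omega) x hn, sub_zero]

end FilteredBialgebra

/-! ### Separating functionals on tensor products -/

/-- Tensor products of separating families of functionals are separating. -/
theorem tensorProduct_eq_of_forall_functionals {K U V I J : Type} [Field K] [AddCommGroup U]
    [Module K U] [AddCommGroup V] [Module K V] {φ : I → U →ₗ[K] K} {ψ : J → V →ₗ[K] K}
    (hφ : ∀ x y, (∀ i, φ i x = φ i y) → x = y) (hψ : ∀ x y, (∀ j, ψ j x = ψ j y) → x = y)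
    {s t : U ⊗[K] V}
    (h : ∀ i j, LinearMap.mul' K K (TensorProduct.map (φ i) (ψ j) s) =
      LinearMap.mul' K K (TensorProduct.map (φ i) (ψ j) t)) : s = t := by
  classical
  let B := Module.Basis.ofVectorSpace K U
  let E := TensorProduct.equivFinsuppOfBasisLeft (N := V) B
  -- Write a tensor as a sum of `B b ⊗ g b`. The `φ i` detect the vector with coordinates `ψ j (g
  -- b)`; linear independence isolates each coordinate, and the `ψ j` then detect `g b`.
  have key : ∀ (s : U ⊗[K] V) (i : I) (j : J),
      LinearMap.mul' K K (TensorProduct.map (φ i) (ψ j) s) =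
        φ i ((E s).sum fun b g => ψ j g • B b) := by
    intro s i j
    conv_lhs => rw [← E.symm_apply_apply s]
    rw [TensorProduct.equivFinsuppOfBasisLeft_symm_apply]
    simp [Finsupp.sum, mul_comm]
  refine E.injective (sub_eq_zero.1 ?_)
  rw [← map_sub]
  ext1 b
  refine hψ _ _ fun j => ?_
  have hz : ((E (s - t)).sum fun b g => ψ j g • B b) = 0 := by
    refine hφ _ _ fun i => ?_
    rw [← key, map_sub, map_sub, h i j, sub_self, map_zero]
  by_cases hb : b ∈ (E (s - t)).support
  · simpa using linearIndependent_iff'.1 B.linearIndependent _ _ hz b hb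
  · rw [Finsupp.notMem_support_iff.1 hb]
    simp

/-! ### Functionals on reassociated and contracted tensors -/

section Functionals

variable {K U V W : Type} [Field K] [AddCommGroup U] [Module K U] [AddCommGroup V] [Module K V]
  [AddCommGroup W] [Module K W]

theorem mul'_map_assoc (α : U →ₗ[K] K) (β : V →ₗ[K] K) (γ : W →ₗ[K] K) (s : (U ⊗[K] V) ⊗[K] W) :
    LinearMap.mul' K K (TensorProduct.map α (LinearMap.mul' K K ∘ₗ TensorProduct.map β γ)
      (TensorProduct.assoc K U V W s)) =
    LinearMap.mul' K K
      (TensorProduct.map (LinearMap.mul' K K ∘ₗ TensorProduct.map α β) γ s) := by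
  refine LinearMap.congr_fun (f := LinearMap.mul' K K ∘ₗ
    TensorProduct.map α (LinearMap.mul' K K ∘ₗ TensorProduct.map β γ) ∘ₗ
    (TensorProduct.assoc K U V W).toLinearMap) (g := LinearMap.mul' K K ∘ₗ
    TensorProduct.map (LinearMap.mul' K K ∘ₗ TensorProduct.map α β) γ) ?_ s
  ext
  simp [mul_assoc]

/-- With `D` a coproduct, this reduces one side of coassociativity to functionals on a twofold
tensor product. -/
theorem mul'_map_assoc_map_id (α : U →ₗ[K] K) (β : V →ₗ[K] K) (γ : W →ₗ[K] K)
    {U' : Type} [AddCommGroup U'] [Module K U'] (D : U' →ₗ[K] U ⊗[K] V) (t : U' ⊗[K] W) :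
    LinearMap.mul' K K (TensorProduct.map α (LinearMap.mul' K K ∘ₗ TensorProduct.map β γ)
      (TensorProduct.assoc K U V W (TensorProduct.map D LinearMap.id t))) =
    LinearMap.mul' K K
      (TensorProduct.map ((LinearMap.mul' K K ∘ₗ TensorProduct.map α β) ∘ₗ D) γ t) := by
  rw [mul'_map_assoc, TensorProduct.map_map]
  rfl

theorem functional_lid_map_id (ε : U →ₗ[K] K) (γ : V →ₗ[K] K) (t : U ⊗[K] V) :
    γ (TensorProduct.lid K V (TensorProduct.map ε LinearMap.id t)) =
      LinearMap.mul' K K (TensorProduct.map ε γ t) := by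
  induction t with
  | zero => simp
  | add s s' hs hs' => simp only [map_add, hs, hs']
  | tmul a b => simp

theorem functional_rid_map_id (ε : V →ₗ[K] K) (γ : U →ₗ[K] K) (t : U ⊗[K] V) :
    γ (TensorProduct.rid K U (TensorProduct.map LinearMap.id ε t)) =
      LinearMap.mul' K K (TensorProduct.map γ ε t) := by
  induction t with
  | zero => simp
  | add s s' hs hs' => simp only [map_add, hs, hs']
  | tmul a b => simp [mul_comm]

end Functionals

/-! ### Words with the same `r`-dominant pattern -/

/-- The words `l.map f` and `l.map g` have the same pattern of equalities, and the same relative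
order of those letters that occur at least `r` times. -/
def RSimilar {X Y Z : Type} [LinearOrder X] [LinearOrder Y] (r : ℕ) (l : List Z) (f : Z → X)
    (g : Z → Y) : Prop :=
  ∀ a ∈ l, ∀ b ∈ l, (f a = f b ↔ g a = g b) ∧
    (r ≤ l.countP (fun c => f c = f a) → r ≤ l.countP (fun c => f c = f b) →
      (f a < f b ↔ g a < g b))

namespace RSimilar

variable {X Y W Z Z' : Type} [LinearOrder X] [LinearOrder Y] [LinearOrder W] {r : ℕ}
  {l l' : List Z} {f : Z → X} {g : Z → Y} {h : Z → W}

theorem of_lt_iff (H : ∀ a ∈ l, ∀ b ∈ l, (f a < f b ↔ g a < g b)) : RSimilar r l f g := by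
  refine fun a ha b hb => ⟨?_, fun _ _ => H a ha b hb⟩
  rw [le_antisymm_iff, le_antisymm_iff, ← not_lt, ← not_lt, ← not_lt, ← not_lt, H a ha b hb,
    H b hb a ha]

/-- Multiplicities depend only on the equality pattern. Thus counting under `f` alone in `RSimilar`
costs no symmetry, as `symm` and `trans` need. -/
theorem countP_eq (H : RSimilar r l f g) {a : Z} (ha : a ∈ l) :
    l.countP (fun c => f c = f a) = l.countP (fun c => g c = g a) :=
  List.countP_congr fun c hc => by simpa using (H c hc a ha).1

theorem refl (r : ℕ) (l : List Z) (f : Z → X) : RSimilar r l f f :=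
  fun _ _ _ _ => ⟨Iff.rfl, fun _ _ => Iff.rfl⟩

theorem symm (H : RSimilar r l f g) : RSimilar r l g f := by
  intro a ha b hb
  rw [← H.countP_eq ha, ← H.countP_eq hb]
  exact ⟨(H a ha b hb).1.symm, fun h1 h2 => ((H a ha b hb).2 h1 h2).symm⟩

theorem trans (H : RSimilar r l f g) (H' : RSimilar r l g h) : RSimilar r l f h := by
  intro a ha b hb
  refine ⟨(H a ha b hb).1.trans (H' a ha b hb).1, fun h1 h2 => ((H a ha b hb).2 h1 h2).trans ?_⟩
  rw [H.countP_eq ha] at h1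
  rw [H.countP_eq hb] at h2
  exact (H' a ha b hb).2 h1 h2

theorem perm (H : RSimilar r l f g) (hl : l'.Perm l) : RSimilar r l' f g := by
  intro a ha b hb
  rw [hl.countP_eq, hl.countP_eq]
  exact H a (hl.mem_iff.1 ha) b (hl.mem_iff.1 hb)

/-- A letter occurring `r` times in a subword does so in the whole word, so the subword imposes no
order condition that was not already there. This is what makes products work. -/
theorem sublist (H : RSimilar r l f g) (hl : l'.Sublist l) : RSimilar r l' f g := fun a ha b hb =>
  ⟨(H a (hl.subset ha) b (hl.subset hb)).1, fun h1 h2 =>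
    (H a (hl.subset ha) b (hl.subset hb)).2 (h1.trans hl.countP_le) (h2.trans hl.countP_le)⟩

theorem map_iff {l : List Z'} {k : Z' → Z} :
    RSimilar r (l.map k) f g ↔ RSimilar r l (f ∘ k) (g ∘ k) := by
  simp [RSimilar, List.countP_map, Function.comp_def]

/-- For `r ≤ 1` every occurring letter is frequent, so similarity fixes the whole order pattern. -/
theorem lt_iff_of_le_one (H : RSimilar r l f g) (hr : r ≤ 1) {a b : Z} (ha : a ∈ l) (hb : b ∈ l) :
    f a < f b ↔ g a < g b :=
  (H a ha b hb).2 (hr.trans (List.countP_pos_iff.2 ⟨a, ha, by simp⟩))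
    (hr.trans (List.countP_pos_iff.2 ⟨b, hb, by simp⟩))

/-- Juxtaposition of two alphabets preserves similarity. -/
theorem sum_append {X' Y' : Type} [LinearOrder X'] [LinearOrder Y'] {l : List Z} {m : List Z'}
    {f' : Z' → X'} {g' : Z' → Y'} (H : RSimilar r l f g) (H' : RSimilar r m f' g') :
    RSimilar r (l.map Sum.inl ++ m.map Sum.inr) (fun z : Z ⊕ Z' => toLex (Sum.map f f' z))
      (fun z : Z ⊕ Z' => toLex (Sum.map g g' z)) := by
  intro a ha b hb
  rcases a with a | a <;> rcases b with b | b <;>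
    simp only [List.mem_append, List.mem_map, Sum.inl.injEq, Sum.inr.injEq, reduceCtorEq,
      and_false, exists_false, or_false, false_or, exists_eq_right] at ha hb
  · have := H a ha b hb
    simpa [List.countP_map, Function.comp_def] using this
  -- In the two mixed cases the letters are distinct and their order is decided by the alphabets
  -- alone.
  · simp
  · simp
  · have := H' a ha b hb
    simpa [List.countP_map, Function.comp_def] using this

end RSimilar

/-! ### Invariant series -/

/-- A series is `r`-invariant if its coefficients only depend on the `r`-dominant pattern. -/
def IsRInvariant {X : Type} [LinearOrder X] (r : ℕ) (F : NCPowerSeries X) : Prop :=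
  ∀ (Z : Type) (l : List Z) (f g : Z → X), RSimilar r l f g → F.coeff (l.map f) = F.coeff (l.map g)

theorem map_eq_ofFn {Z X : Type} (l : List Z) (f : Z → X) :
    l.map f = List.ofFn fun j : Fin l.length => f l[j] := by
  apply List.ext_getElem <;> simp

/-- Makes every statement about invariant series available, at `r = 1`, for all of `NCQSym`. -/
theorem IsNCQuasisymmetric.isRInvariant_one {X : Type} [LinearOrder X] {F : NCPowerSeries X}
    (hF : IsNCQuasisymmetric F) : IsRInvariant 1 F := by
  intro Z l f g H
  rw [map_eq_ofFn, map_eq_ofFn]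
  exact hF.coeff_eq fun j k => H.lt_iff_of_le_one le_rfl (by simp) (by simp)

namespace IsRInvariant

variable {X : Type} [LinearOrder X] {r s : ℕ} {F G : NCPowerSeries X}

theorem add (hF : IsRInvariant r F) (hG : IsRInvariant r G) : IsRInvariant r (F + G) :=
  fun Z l f g H => by rw [map_add, map_add, hF Z l f g H, hG Z l f g H]

theorem smul (c : ℚ) (hF : IsRInvariant r F) : IsRInvariant r (c • F) :=
  fun Z l f g H => by rw [map_smul, map_smul, hF Z l f g H]

theorem one : IsRInvariant r (1 : NCPowerSeries X) :=
  fun Z l f g H => by simp [NCPowerSeries.coeff_one]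

theorem mul (hF : IsRInvariant r F) (hG : IsRInvariant r G) : IsRInvariant r (F * G) := by
  intro Z l f g H
  rw [NCPowerSeries.coeff_mul, NCPowerSeries.coeff_mul, List.length_map, List.length_map]
  refine Finset.sum_congr rfl fun k _ => ?_
  simp only [← List.map_take, ← List.map_drop]
  rw [hF Z _ f g (H.sublist (List.take_sublist k l)), hG Z _ f g (H.sublist (List.drop_sublist k l))]

/-- An `r`-invariant series is quasisymmetric as soon as its degrees are bounded. -/
theorem isNCQuasisymmetric (hF : IsRInvariant r F)
    (hd : ∃ d : ℕ, ∀ w : List X, d < w.length → F.coeff w = 0) : IsNCQuasisymmetric F := by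
  refine ⟨hd, fun n Φ i i' hi hi' => ?_⟩
  have := hF (Fin n) (List.finRange n) i i' (RSimilar.of_lt_iff fun a _ b _ => hi.lt_iff hi' a b)
  simpa only [← List.ofFn_eq_map] using this

end IsRInvariant

/-! ### Evaluation at other alphabets -/

theorem rSimilar_letterRank {Y : Type} [LinearOrder Y] (r : ℕ) (w : List Y) :
    RSimilar r w (letterRank w) id :=
  RSimilar.of_lt_iff fun _ ha _ hb => letterRank_lt_iff ha hb

theorem rSimilar_letterRank_map {Z Y : Type} [LinearOrder Y] (r : ℕ) (l : List Z)
    (f : Z → Y) : RSimilar r l (letterRank (l.map f) ∘ f) f :=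
  RSimilar.map_iff.1 (rSimilar_letterRank r (l.map f))

/-- Evaluations of an `r`-invariant series agree at words with the same `r`-dominant pattern, even
if these are words in different alphabets. -/
theorem NCQSym.coeff_eval_eq {r : ℕ} {f : NCQSym ℕ+} (hf : IsRInvariant r f.1) {X Y Z : Type}
    [LinearOrder X] [LinearOrder Y] {l : List Z} {a : Z → X} {b : Z → Y} (H : RSimilar r l a b) :
    (NCQSym.eval f : NCQSym X).1.coeff (l.map a) = (NCQSym.eval f : NCQSym Y).1.coeff (l.map b) := by
  rw [NCQSym.coeff_eval, NCQSym.coeff_eval, List.map_map, List.map_map]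
  exact hf Z l _ _ (((rSimilar_letterRank_map r l a).trans H).trans (rSimilar_letterRank_map r l b).symm)

/-- The two sides rank the letters of a factor within the whole word and within the factor,
respectively. Both rankings preserve order, so quasisymmetry identifies the coefficients. -/
theorem NCQSym.eval_mul {X : Type} [LinearOrder X] (f g : NCQSym ℕ+) :
    (NCQSym.eval (f * g) : NCQSym X) = NCQSym.eval f * NCQSym.eval g := by
  refine Subtype.ext (NCPowerSeries.ext fun w => ?_)
  rw [NCQSym.coeff_eval, MulMemClass.coe_mul, MulMemClass.coe_mul, NCPowerSeries.coeff_mul,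
    NCPowerSeries.coeff_mul, List.length_map]
  refine Finset.sum_congr rfl fun k _ => ?_
  have key : ∀ (f : NCQSym ℕ+) (v : List X), v.Sublist w →
      f.1.coeff (v.map (letterRank w)) = (NCQSym.eval f : NCQSym X).1.coeff v := fun f v hv =>
    f.2.isRInvariant_one X v _ _
      (((rSimilar_letterRank 1 w).sublist hv).trans (rSimilar_letterRank 1 v).symm)
  rw [← List.map_take, ← List.map_drop, key f _ (List.take_sublist k w),
    key g _ (List.drop_sublist k w)]

theorem NCQSym.eval_one {X : Type} [LinearOrder X] :
    (NCQSym.eval (1 : NCQSym ℕ+) : NCQSym X) = 1 := by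
  refine Subtype.ext (NCPowerSeries.ext fun w => ?_)
  rw [NCQSym.coeff_eval, OneMemClass.coe_one, OneMemClass.coe_one, NCPowerSeries.coeff_one,
    NCPowerSeries.coeff_one]
  simp

/-! ### Sums over shuffles -/

/-- The series with given coefficients. -/
def NCPowerSeries.ofCoeff {X : Type} (φ : List X → ℚ) : NCPowerSeries X := φ

@[simp] theorem NCPowerSeries.coeff_ofCoeff {X : Type} (φ : List X → ℚ) (w : List X) :
    NCPowerSeries.coeff w (NCPowerSeries.ofCoeff φ) = φ w := rfl

open NCPowerSeries in
/-- The sum of the coefficients of a series over all shuffles of two words, with multiplicity. -/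
def shuffleSum {X : Type} : NCPowerSeries X → List X → List X → ℚ
  | F, [], v => coeff v F
  | F, a :: u, [] => coeff (a :: u) F
  | F, a :: u, b :: v => shuffleSum (shift a F) u (b :: v) + shuffleSum (shift b F) (a :: u) v
termination_by _ u v => u.length + v.length

section ShuffleSum

open NCPowerSeries

variable {X Y Z : Type}

@[simp] theorem shuffleSum_nil_left (F : NCPowerSeries X) (v : List X) :
    shuffleSum F [] v = coeff v F := by rw [shuffleSum]

@[simp] theorem shuffleSum_nil_right (F : NCPowerSeries X) (u : List X) :
    shuffleSum F u [] = coeff u F := by cases u <;> rw [shuffleSum]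

theorem shuffleSum_cons_cons (F : NCPowerSeries X) (a b : X) (u v : List X) :
    shuffleSum F (a :: u) (b :: v) =
      shuffleSum (shift a F) u (b :: v) + shuffleSum (shift b F) (a :: u) v := by
  rw [shuffleSum]

theorem shuffleSum_add (F G : NCPowerSeries X) (u v : List X) :
    shuffleSum (F + G) u v = shuffleSum F u v + shuffleSum G u v := by
  induction u generalizing F G v with
  | nil => simp
  | cons a u ih =>
    induction v generalizing F G with
    | nil => simp
    | cons b v ih' =>
      simp only [shuffleSum_cons_cons, map_add, ih, ih']
      ring

theorem shuffleSum_smul (c : ℚ) (F : NCPowerSeries X) (u v : List X) :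
    shuffleSum (c • F) u v = c * shuffleSum F u v := by
  induction u generalizing F v with
  | nil => simp
  | cons a u ih =>
    induction v generalizing F with
    | nil => simp
    | cons b v ih' =>
      simp only [shuffleSum_cons_cons, map_smul, ih, ih']
      ring

/-- Interleavings can be formed on the labels before applying `f` or `g`, and each is a permutation
of `l ++ m`. Comparisons of shuffle sums across alphabets go through this lemma. -/
theorem shuffleSum_map_congr {F : NCPowerSeries X} {G : NCPowerSeries Y} {l m : List Z} {f : Z → X}
    {g : Z → Y} (h : ∀ w : List Z, w.Perm (l ++ m) → coeff (w.map f) F = coeff (w.map g) G) :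
    shuffleSum F (l.map f) (m.map f) = shuffleSum G (l.map g) (m.map g) := by
  induction l generalizing F G m with
  | nil => simpa using h m (by simp)
  | cons a l ih =>
    induction m generalizing F G with
    | nil => simpa using h (a :: l) (by simp)
    | cons b m ih' =>
      simp only [List.map_cons, shuffleSum_cons_cons] at ih' ⊢
      congr 1
      · have := ih (F := shift (f a) F) (G := shift (g a) G) (m := b :: m) fun w hw => by
          simpa [coeff_shift] using h (a :: w) (hw.cons a)
        simpa using this
      · refine ih' fun w hw => ?_
        simpa [coeff_shift] using h (b :: w) ((hw.cons b).trans List.perm_middle.symm)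

/-- The two words have no letter in common, so distinct interleavings are distinct words and every
multiplicity is one. -/
theorem sum_shuffles_eq_shuffleSum [DecidableEq X] [DecidableEq Y] (F : NCPowerSeries (X ⊕ₗ Y))
    (u : List X) (v : List Y) :
    ∑ w ∈ shuffles u v, coeff w F = shuffleSum F (u.map Sum.inlₗ) (v.map Sum.inrₗ) := by
  induction u generalizing F v with
  | nil => simp [shuffles]
  | cons a u ih =>
    induction v generalizing F with
    | nil => simp [shuffles]
    | cons b v ih' =>
      rw [shuffles, Finset.sum_union, Finset.sum_image (by simp), Finset.sum_image (by simp)]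
      · simp only [← coeff_shift, ih, ih', List.map_cons, shuffleSum_cons_cons]
      · rw [Finset.disjoint_left]
        intro w hw hw'
        obtain ⟨w₁, -, rfl⟩ := Finset.mem_image.1 hw
        obtain ⟨w₂, -, h⟩ := Finset.mem_image.1 hw'
        simp [Sum.inlₗ, Sum.inrₗ] at h

/-- Shuffling a word with the shuffles of two words. -/
theorem shuffleSum_assoc (F : NCPowerSeries X) (u v w : List X) :
    shuffleSum (ofCoeff fun z => shuffleSum F z w) u v =
      shuffleSum (ofCoeff fun z => shuffleSum F u z) v w := by
  have hl : ∀ (F : NCPowerSeries X) (a c : X) (w : List X),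
      shift a (ofCoeff fun z => shuffleSum F z (c :: w)) =
        (ofCoeff fun z => shuffleSum (shift a F) z (c :: w)) +
          shift a (ofCoeff fun z => shuffleSum (shift c F) z w) :=
    fun F a c w => funext fun z => shuffleSum_cons_cons F a c z w
  have hr : ∀ (F : NCPowerSeries X) (a c : X) (w : List X),
      shift a (ofCoeff fun z => shuffleSum F (c :: w) z) =
        shift a (ofCoeff fun z => shuffleSum (shift c F) w z) +
        (ofCoeff fun z => shuffleSum (shift a F) (c :: w) z) :=
    fun F a c w => funext fun z => shuffleSum_cons_cons F c a w z
  have hnl : ∀ F : NCPowerSeries X, (ofCoeff fun z => shuffleSum F z []) = F :=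
    fun F => funext fun z => shuffleSum_nil_right F z
  have hnr : ∀ F : NCPowerSeries X, (ofCoeff fun z => shuffleSum F [] z) = F :=
    fun F => funext fun z => shuffleSum_nil_left F z
  induction u generalizing F v w with
  | nil => rw [hnr, shuffleSum_nil_left]; simp
  | cons a u ihu =>
    induction v generalizing F w with
    | nil => rw [shuffleSum_nil_right, shuffleSum_nil_left]; simp
    | cons b v ihv =>
      induction w generalizing F with
      | nil => rw [hnl, shuffleSum_nil_right]; simp
      | cons c w ihw =>
        -- A shuffle of the three words starts with `a`, `b` or `c`: one induction hypothesis for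
        -- each.
        have e1 := ihu (shift a F) (b :: v) (c :: w)
        have e2 := ihv (shift b F) (c :: w)
        have e3 := ihw (shift c F)
        rw [shuffleSum_cons_cons] at e3 e1 ⊢
        rw [hl, hl, shuffleSum_add, shuffleSum_add]
        rw [shuffleSum_cons_cons _ b c v w, hr, hr, shuffleSum_add, shuffleSum_add]
        linarith

/-- Cutting a shuffle of `u` and `v` in two cuts `u` after `i` letters and `v` after `j`; the pieces
are arbitrary shuffles of the prefixes and of the suffixes. -/
theorem shuffleSum_mul (F G : NCPowerSeries X) (u v : List X) :
    shuffleSum (F * G) u v = ∑ i ∈ Finset.range (u.length + 1), ∑ j ∈ Finset.range (v.length + 1),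
      shuffleSum F (u.take i) (v.take j) * shuffleSum G (u.drop i) (v.drop j) := by
  induction u generalizing F v with
  | nil => simp [coeff_mul]
  | cons a u ih =>
    induction v generalizing F with
    | nil => simp [coeff_mul]
    | cons b v ih' =>
      rw [shuffleSum_cons_cons, shift_mul, shift_mul, shuffleSum_add, shuffleSum_add,
        shuffleSum_smul, shuffleSum_smul, ih, ih']
      simp only [List.length_cons, Finset.sum_range_succ' _ (u.length + 1),
        Finset.sum_range_succ' _ (v.length + 1), List.take_succ_cons, List.take_zero,
        List.drop_succ_cons, List.drop_zero, shuffleSum_cons_cons, add_mul,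
        Finset.sum_add_distrib, shuffleSum_nil_left, shuffleSum_nil_right, coeff_shift]
      ring

end ShuffleSum

/-! ### Set compositions and dominant patterns -/

theorem card_filter_eq_countP_finRange {n : ℕ} (p : Fin n → Prop) [DecidablePred p] :
    (Finset.univ.filter p).card = (List.finRange n).countP (fun j => p j) := by
  rw [List.countP_eq_length_filter]
  rfl

namespace RSetComposition

variable {r n : ℕ} {X Y : Type} [LinearOrder X] [LinearOrder Y]

/-- Order is imposed only between blocks of `Φ.comp`. These have at least `r` elements, so they
carry frequent letters, whose order similarity preserves. -/
theorem Compatible.of_rSimilar {Φ : RSetComposition r n} {i : Fin n → X} {i' : Fin n → Y}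
    (h : Φ.Compatible i) (H : RSimilar r (List.finRange n) i i') : Φ.Compatible i' := by
  have key : ∀ B ∈ Φ.comp.blocks, ∀ j ∈ B, r ≤ (List.finRange n).countP (fun c => i c = i j) := by
    intro B hB j hj
    rw [← card_filter_eq_countP_finRange]
    refine (Φ.le_card B hB).trans (Finset.card_le_card fun k hk => ?_)
    simpa using (h.1 k j).2 (Or.inl ⟨B, hB, hk, hj⟩)
  refine ⟨fun j k => ?_, h.2.imp_of_mem fun {B C} hB hC hBC j hj k hk => ?_⟩
  · rw [← h.1 j k]
    exact (H j (by simp) k (by simp)).1.symm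
  · exact ((H j (by simp) k (by simp)).2 (key B hB j hj) (key C hC k hk)).1 (hBC j hj k hk)

variable (r) in
/-- The positions of those letters that occur at least `r` times. -/
def dominantPositions (i : Fin n → X) : Finset (Fin n) :=
  Finset.univ.filter fun j => r ≤ (Finset.univ.filter fun k => i k = i j).card

theorem mem_dominantPositions {i : Fin n → X} {j : Fin n} : j ∈ dominantPositions r i ↔
    r ≤ (Finset.univ.filter fun k => i k = i j).card := by
  simp [dominantPositions]

theorem mem_dominantPositions_congr {i : Fin n → X} {j k : Fin n} (h : i j = i k) :
    j ∈ dominantPositions r i ↔ k ∈ dominantPositions r i := by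
  rw [mem_dominantPositions, mem_dominantPositions, h]

variable (r) in
/-- The `r`-set-composition given by the level sets of an index tuple. -/
def ofTuple (i : Fin n → X) : RSetComposition r n where
  support := dominantPositions r i
  comp :=
    { blocks := (((dominantPositions r i).image i).sort (· ≤ ·)).map fun a =>
        Finset.univ.filter fun j => i j = a
      nonempty := by
        intro B hB
        obtain ⟨a, ha, rfl⟩ := List.mem_map.1 hB
        obtain ⟨j, -, rfl⟩ := Finset.mem_image.1 ((Finset.mem_sort _).1 ha)
        exact ⟨j, by simp⟩
      disjoint := by
        rw [List.pairwise_map]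
        refine (Finset.sort_nodup _ _).imp fun {a b} hab => ?_
        rw [Finset.disjoint_left]
        intro j hj hj'
        simp only [Finset.mem_filter, Finset.mem_univ, true_and] at hj hj'
        exact hab (hj.symm.trans hj')
      mem_iff := by
        intro j
        simp only [List.mem_map, Finset.mem_sort, Finset.mem_image]
        constructor
        · intro hj
          exact ⟨_, ⟨i j, ⟨j, hj, rfl⟩, rfl⟩, by simp⟩
        · rintro ⟨_, ⟨_, ⟨k, hk, rfl⟩, rfl⟩, hj⟩
          exact (mem_dominantPositions_congr (by simpa using hj)).2 hk }
  part := Finpartition.ofExistsUnique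
    ((Finset.univ \ dominantPositions r i).image fun j => Finset.univ.filter fun k => i k = i j)
    (by
      intro B hB k hk
      obtain ⟨j, hj, rfl⟩ := Finset.mem_image.1 hB
      simp only [Finset.mem_sdiff, Finset.mem_univ, true_and, Finset.mem_filter] at hj hk ⊢
      rwa [mem_dominantPositions_congr hk])
    (by
      intro j hj
      refine ⟨Finset.univ.filter fun k => i k = i j, ⟨Finset.mem_image_of_mem _ hj, by simp⟩, ?_⟩
      rintro B ⟨hB, hjB⟩
      obtain ⟨k, hk, rfl⟩ := Finset.mem_image.1 hB
      simp only [Finset.mem_filter, Finset.mem_univ, true_and] at hjB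
      rw [hjB])
    (by
      intro h
      obtain ⟨j, -, hj⟩ := Finset.mem_image.1 h
      exact Finset.notMem_empty j (hj ▸ by simp))
  le_card := by
    intro B hB
    obtain ⟨a, ha, rfl⟩ := List.mem_map.1 hB
    obtain ⟨j, hj, rfl⟩ := Finset.mem_image.1 ((Finset.mem_sort _).1 ha)
    exact mem_dominantPositions.1 hj
  card_lt := by
    intro B hB
    obtain ⟨j, hj, rfl⟩ := Finset.mem_image.1 hB
    rw [Finset.mem_sdiff, mem_dominantPositions] at hj
    exact not_le.1 hj.2

theorem mem_blocks_ofTuple {i : Fin n → X} {B : Finset (Fin n)} :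
    B ∈ (ofTuple r i).comp.blocks ↔
      ∃ j ∈ dominantPositions r i, B = Finset.univ.filter fun k => i k = i j := by
  simp [ofTuple, eq_comm]

theorem mem_parts_ofTuple {i : Fin n → X} {B : Finset (Fin n)} :
    B ∈ (ofTuple r i).part.parts ↔
      ∃ j ∉ dominantPositions r i, B = Finset.univ.filter fun k => i k = i j := by
  simp [ofTuple, Finpartition.ofExistsUnique, eq_comm]

theorem compatible_ofTuple (i : Fin n → X) : (ofTuple r i).Compatible i := by
  refine ⟨fun j k => ⟨fun h => ?_, ?_⟩, ?_⟩
  · by_cases hj : j ∈ dominantPositions r i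
    · exact Or.inl ⟨_, mem_blocks_ofTuple.2 ⟨j, hj, rfl⟩, by simp, by simp [h]⟩
    · exact Or.inr ⟨_, mem_parts_ofTuple.2 ⟨j, hj, rfl⟩, by simp, by simp [h]⟩
  · rintro (⟨B, hB, hj, hk⟩ | ⟨B, hB, hj, hk⟩)
    · obtain ⟨l, -, rfl⟩ := mem_blocks_ofTuple.1 hB
      simp only [Finset.mem_filter, Finset.mem_univ, true_and] at hj hk
      rw [hj, hk]
    · obtain ⟨l, -, rfl⟩ := mem_parts_ofTuple.1 hB
      simp only [Finset.mem_filter, Finset.mem_univ, true_and] at hj hk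
      rw [hj, hk]
  · unfold ofTuple
    rw [List.pairwise_map]
    refine (Finset.sortedLT_sort _).pairwise.imp fun {a b} hab j hj k hk => ?_
    simp only [Finset.mem_filter, Finset.mem_univ, true_and] at hj hk
    rwa [hj, hk]

/-- Shows that the dominant monomial function attached to `i` is the indicator function of the
similarity class of `i`. -/
theorem compatible_ofTuple_iff {i : Fin n → X} {i' : Fin n → Y} :
    (ofTuple r i).Compatible i' ↔ RSimilar r (List.finRange n) i i' := by
  refine ⟨fun h => ?_, fun H => (compatible_ofTuple i).of_rSimilar H⟩
  have heq : ∀ j k, i j = i k ↔ i' j = i' k := fun j k =>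
    ((compatible_ofTuple (r := r) i).1 j k).trans (h.1 j k).symm
  have hlt : ∀ j ∈ dominantPositions r i, ∀ k ∈ dominantPositions r i, i j < i k → i' j < i' k := by
    intro j hj k hk hjk
    obtain ⟨b, hb⟩ := List.mem_iff_get.1 (mem_blocks_ofTuple.2 ⟨j, hj, rfl⟩)
    obtain ⟨c, hc⟩ := List.mem_iff_get.1 (mem_blocks_ofTuple.2 ⟨k, hk, rfl⟩)
    -- As `i` is itself compatible, `i j < i k` forces the block of `j` to come before that of `k`
    -- in the list.
    rcases lt_trichotomy b c with hbc | rfl | hbc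
    · exact List.pairwise_iff_get.1 h.2 b c hbc j (by rw [hb]; simp) k (by rw [hc]; simp)
    · have : j ∈ Finset.univ.filter fun l => i l = i k := by
        rw [← hc, hb]
        simp
      exact absurd (by simpa using this) hjk.ne
    · exact absurd (List.pairwise_iff_get.1 (compatible_ofTuple (r := r) i).2 c b hbc k
        (by rw [hc]; simp) j (by rw [hb]; simp)) hjk.not_gt
  intro j _ k _
  refine ⟨heq j k, fun hj hk => ⟨?_, fun hjk => ?_⟩⟩
  all_goals
    rw [← card_filter_eq_countP_finRange, ← mem_dominantPositions] at hj hk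
  · exact hlt j hj k hk
  · rcases lt_trichotomy (i j) (i k) with h' | h' | h'
    · exact h'
    · exact absurd ((heq j k).1 h') hjk.ne
    · exact absurd (hlt k hk j hj h') hjk.not_gt

end RSetComposition

/-! ### Expansion of invariant series in dominant monomial functions -/

theorem coeff_ofFn_rDominantMonomial {r n : ℕ} (Φ : RSetComposition r n) (i : Fin n → ℕ+)
    [Decidable (Φ.Compatible i)] :
    (rDominantMonomial Φ).1.coeff (List.ofFn i) = if Φ.Compatible i then 1 else 0 := by
  classical
  refine if_congr ⟨?_, fun h => ⟨i, h, rfl⟩⟩ rfl rfl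
  rintro ⟨i', h, e⟩
  rwa [List.ofFn_injective e]

theorem coeff_rDominantMonomial_of_length_ne {r n : ℕ} (Φ : RSetComposition r n) {w : List ℕ+}
    (h : w.length ≠ n) : (rDominantMonomial Φ).1.coeff w = 0 := by
  classical
  refine if_neg ?_
  rintro ⟨i, -, rfl⟩
  simp at h

theorem isRInvariant_rDominantMonomial {r n : ℕ} (Φ : RSetComposition r n) :
    IsRInvariant r (rDominantMonomial Φ).1 := by
  classical
  intro Z l f g H
  by_cases hn : l.length = n
  · subst hn
    rw [map_eq_ofFn, map_eq_ofFn, coeff_ofFn_rDominantMonomial, coeff_ofFn_rDominantMonomial]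
    have hl : (List.finRange l.length).map (fun j : Fin l.length => l[j]) = l := by
      apply List.ext_getElem <;> simp
    have H' : RSimilar r ((List.finRange l.length).map fun j : Fin l.length => l[j]) f g := by
      rwa [hl]
    have := RSimilar.map_iff.1 H'
    exact if_congr ⟨fun h => h.of_rSimilar this, fun h => h.of_rSimilar this.symm⟩ rfl rfl
  · rw [coeff_rDominantMonomial_of_length_ne Φ (by simpa using hn),
      coeff_rDominantMonomial_of_length_ne Φ (by simpa using hn)]

/-- Having the same `r`-dominant pattern is an equivalence relation on index tuples. -/
def rSimilarSetoid (r n : ℕ) : Setoid (Fin n → ℕ+) where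
  r := fun i i' => RSimilar r (List.finRange n) i i'
  iseqv := ⟨fun i => RSimilar.refl r _ i, RSimilar.symm, RSimilar.trans⟩

instance (r n : ℕ) : Finite (Quotient (rSimilarSetoid r n)) := by
  let φ : Quotient (rSimilarSetoid r n) → Fin n → Fin n → Prop × Prop :=
    fun c j k => (c.out j = c.out k, c.out j < c.out k)
  refine Finite.of_injective φ fun c c' h => ?_
  rw [← Quotient.out_equiv_out]
  refine RSimilar.of_lt_iff fun j _ k _ => ?_
  have := congrArg Prod.snd (congrFun (congrFun h j) k)
  simpa [φ] using this

noncomputable instance (r n : ℕ) : Fintype (Quotient (rSimilarSetoid r n)) := Fintype.ofFinite _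

/-- Expansion of the homogeneous components of an `r`-invariant series in dominant monomial
functions. -/
theorem IsRInvariant.coeff_eq_sum {r : ℕ} {F : NCPowerSeries ℕ+} (hF : IsRInvariant r F) {n : ℕ}
    {w : List ℕ+} (hw : w.length = n) :
    F.coeff w = ∑ c : Quotient (rSimilarSetoid r n), F.coeff (List.ofFn c.out) *
      (rDominantMonomial (RSetComposition.ofTuple r c.out)).1.coeff w := by
  classical
  subst hw
  obtain ⟨i, hi⟩ : ∃ i : Fin w.length → ℕ+, w = List.ofFn i := ⟨_, (ofFn_getElem_self w).symm⟩
  generalize w.length = n at i hi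
  subst hi
  -- The summands are supported on disjoint similarity classes, so only the class of `i`
  -- contributes.
  rw [Finset.sum_eq_single (Quotient.mk (rSimilarSetoid r n) i)]
  · have h : RSimilar r (List.finRange n) (Quotient.mk (rSimilarSetoid r n) i).out i :=
      Quotient.mk_out (s := rSimilarSetoid r n) i
    rw [coeff_ofFn_rDominantMonomial, if_pos (RSetComposition.compatible_ofTuple_iff.2 h), mul_one,
      List.ofFn_eq_map, List.ofFn_eq_map]
    exact (hF _ _ _ _ h).symm
  · intro c _ hc
    rw [coeff_ofFn_rDominantMonomial, if_neg, mul_zero]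
    intro h
    refine hc ?_
    rw [← Quotient.out_eq c]
    exact Quotient.sound (RSetComposition.compatible_ofTuple_iff.1 h)
  · simp

/-- Expansion of an `r`-invariant series of bounded degree in dominant monomial functions. -/
theorem IsRInvariant.coeff_eq_sum_sum {r : ℕ} {F : NCPowerSeries ℕ+} (hF : IsRInvariant r F) {d : ℕ}
    (hd : ∀ w : List ℕ+, d < w.length → F.coeff w = 0) (w : List ℕ+) :
    F.coeff w = ∑ n ∈ Finset.range (d + 1), ∑ c : Quotient (rSimilarSetoid r n),
      F.coeff (List.ofFn c.out) *
        (rDominantMonomial (RSetComposition.ofTuple r c.out)).1.coeff w := by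
  have hz : ∀ n ≠ w.length, ∑ c : Quotient (rSimilarSetoid r n), F.coeff (List.ofFn c.out) *
      (rDominantMonomial (RSetComposition.ofTuple r c.out)).1.coeff w = 0 := fun n hn =>
    Finset.sum_eq_zero fun c _ => by
      rw [coeff_rDominantMonomial_of_length_ne _ hn.symm, mul_zero]
  rw [Finset.sum_eq_single w.length (fun n _ hn => hz n hn)]
  · exact hF.coeff_eq_sum rfl
  -- A word longer than `d` has no matching degree in the range; its coefficient vanishes by `hd`.
  · intro h
    rw [← hF.coeff_eq_sum rfl]
    exact hd w (by simpa using h)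

/-- The subalgebra of `r`-invariant series in `NCQSym`. -/
def NCQSymRSubalgebra (r : ℕ) : Subalgebra ℚ (NCQSym ℕ+) where
  carrier := {f | IsRInvariant r f.1}
  mul_mem' := fun hf hg => hf.mul hg
  add_mem' := fun hf hg => hf.add hg
  algebraMap_mem' := fun c => by
    rw [Algebra.algebraMap_eq_smul_one]
    exact IsRInvariant.one.smul c

theorem toSubmodule_NCQSymRSubalgebra (r : ℕ) :
    Subalgebra.toSubmodule (NCQSymRSubalgebra r) = NCQSymR r := by
  apply le_antisymm
  · intro f hf
    have hf' : IsRInvariant r f.1 := hf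
    obtain ⟨d, hd⟩ := f.2.1
    have : f = ∑ n ∈ Finset.range (d + 1), ∑ c : Quotient (rSimilarSetoid r n),
        f.1.coeff (List.ofFn c.out) • rDominantMonomial (RSetComposition.ofTuple r c.out) := by
      refine Subtype.ext (NCPowerSeries.ext fun w => ?_)
      rw [hf'.coeff_eq_sum_sum hd w]
      simp
    rw [this]
    refine Submodule.sum_mem _ fun n _ => Submodule.sum_mem _ fun c _ => Submodule.smul_mem _ _ ?_
    exact Submodule.mem_iSup_of_mem n (Submodule.subset_span ⟨_, rfl⟩)
  · refine iSup_le fun n => Submodule.span_le.2 ?_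
    rintro _ ⟨Φ, rfl⟩
    exact isRInvariant_rDominantMonomial Φ

/-! ### The coefficients of the coproduct -/

/-- The coefficient at `u v` of the series obtained from the evaluation of `f` at an alphabet
`x < y` by imposing the relations `x_i y_j = y_j x_i`. -/
def NCQSym.shuffleCoeff {X Y : Type} [LinearOrder X] [LinearOrder Y] (f : NCQSym ℕ+) (u : List X)
    (v : List Y) : ℚ :=
  shuffleSum (NCQSym.eval f : NCQSym (X ⊕ₗ Y)).1 (u.map Sum.inlₗ) (v.map Sum.inrₗ)

namespace NCQSym

variable {X Y X' Y' Z Z' W : Type} [LinearOrder X] [LinearOrder Y] [LinearOrder X'] [LinearOrder Y']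
  [LinearOrder W] {r : ℕ} {f g : NCQSym ℕ+}

theorem coeffBar_eq_shuffleCoeff (f : NCQSym ℕ+) (u v : List ℕ+) :
    coeffBar f u v = shuffleCoeff f u v :=
  sum_shuffles_eq_shuffleSum _ u v

/-- Similarity of the two words passes to their concatenation over the juxtaposed alphabets, hence
to each of its permutations and so to each shuffle. -/
theorem shuffleCoeff_map_eq (hf : IsRInvariant r f.1) {l : List Z} {m : List Z'} {a : Z → X}
    {b : Z → Y} {a' : Z' → X'} {b' : Z' → Y'} (H : RSimilar r l a b) (H' : RSimilar r m a' b') :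
    shuffleCoeff f (l.map a) (m.map a') = shuffleCoeff f (l.map b) (m.map b') := by
  have := shuffleSum_map_congr (F := (eval f : NCQSym (X ⊕ₗ X')).1)
    (G := (eval f : NCQSym (Y ⊕ₗ Y')).1) (l := l.map Sum.inl) (m := m.map Sum.inr)
    (fun w hw => coeff_eval_eq hf ((H.sum_append H').perm hw))
  simpa [shuffleCoeff, List.map_map, Function.comp_def] using this

/-- Moves a shuffle sum into any larger ordered alphabet, such as the reassociated `x < y < z` used
for coassociativity. -/
theorem shuffleCoeff_eq_shuffleSum (f : NCQSym ℕ+) {φ : X ⊕ₗ Y → W} (hφ : StrictMono φ) (u : List X)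
    (v : List Y) : shuffleCoeff f u v = shuffleSum (eval f : NCQSym W).1
      (u.map fun x => φ (Sum.inlₗ x)) (v.map fun y => φ (Sum.inrₗ y)) := by
  have := shuffleSum_map_congr (F := (eval f : NCQSym (X ⊕ₗ Y)).1) (G := (eval f : NCQSym W).1)
    (l := u.map Sum.inlₗ) (m := v.map Sum.inrₗ) (f := id) (g := φ)
    (fun w hw => coeff_eval_eq f.2.isRInvariant_one
      (RSimilar.of_lt_iff fun a _ b _ => hφ.lt_iff_lt.symm))
  simpa [shuffleCoeff, List.map_map, Function.comp_def] using this

/-- In an iterated coproduct, `z` is a shuffle over a composite alphabet; its standardization to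
positive integers can be undone. -/
theorem shuffleCoeff_letterRank_left (f : NCQSym ℕ+) (z : List X) (w : List Y) :
    shuffleCoeff f (z.map (letterRank z)) w = shuffleCoeff f z w := by
  simpa using shuffleCoeff_map_eq f.2.isRInvariant_one (rSimilar_letterRank 1 z)
    (RSimilar.refl 1 w id)

theorem shuffleCoeff_letterRank_right (f : NCQSym ℕ+) (z : List X) (w : List Y) :
    shuffleCoeff f z (w.map (letterRank w)) = shuffleCoeff f z w := by
  simpa using shuffleCoeff_map_eq f.2.isRInvariant_one (RSimilar.refl 1 z id)
    (rSimilar_letterRank 1 w)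

theorem shuffleCoeff_add (f g : NCQSym ℕ+) (u : List X) (v : List Y) :
    shuffleCoeff (f + g) u v = shuffleCoeff f u v + shuffleCoeff g u v :=
  shuffleSum_add _ _ _ _

theorem shuffleCoeff_smul (c : ℚ) (f : NCQSym ℕ+) (u : List X) (v : List Y) :
    shuffleCoeff (c • f) u v = c * shuffleCoeff f u v :=
  shuffleSum_smul c _ _ _

theorem shuffleCoeff_mul (f g : NCQSym ℕ+) (u : List X) (v : List Y) :
    shuffleCoeff (f * g) u v =
      ∑ i ∈ Finset.range (u.length + 1), ∑ j ∈ Finset.range (v.length + 1),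
        shuffleCoeff f (u.take i) (v.take j) * shuffleCoeff g (u.drop i) (v.drop j) := by
  rw [shuffleCoeff, eval_mul, MulMemClass.coe_mul, shuffleSum_mul]
  simp only [List.length_map, ← List.map_take, ← List.map_drop]
  rfl

theorem shuffleCoeff_one (u : List X) (v : List Y) :
    shuffleCoeff (1 : NCQSym ℕ+) u v = (if u = [] then 1 else 0) * (if v = [] then 1 else 0) := by
  -- Zero is written as a scalar multiple so that `shuffleSum_smul` evaluates its shuffle sum.
  have hs : ∀ a : X ⊕ₗ Y, NCPowerSeries.shift a (1 : NCPowerSeries (X ⊕ₗ Y)) = (0 : ℚ) • 1 :=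
    fun a => NCPowerSeries.ext fun w => by
      simp [NCPowerSeries.coeff_shift, NCPowerSeries.coeff_one]
  rw [shuffleCoeff, eval_one, OneMemClass.coe_one]
  cases u <;> cases v <;>
    simp [NCPowerSeries.coeff_one, shuffleSum_cons_cons, hs, shuffleSum_smul, -zero_smul]

theorem shuffleCoeff_nil_left (f : NCQSym ℕ+) (v : List ℕ+) :
    shuffleCoeff f ([] : List X) v = f.1.coeff v := by
  conv_rhs => rw [← eval_self f, ← List.map_id v]
  rw [shuffleCoeff, List.map_nil, shuffleSum_nil_left]
  exact coeff_eval_eq f.2.isRInvariant_one (RSimilar.of_lt_iff fun a _ b _ => by simp [Sum.inrₗ])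

theorem shuffleCoeff_nil_right (f : NCQSym ℕ+) (u : List ℕ+) :
    shuffleCoeff f u ([] : List Y) = f.1.coeff u := by
  conv_rhs => rw [← eval_self f, ← List.map_id u]
  rw [shuffleCoeff, List.map_nil, shuffleSum_nil_right]
  exact coeff_eval_eq f.2.isRInvariant_one (RSimilar.of_lt_iff fun a _ b _ => by simp [Sum.inlₗ])

theorem shuffleCoeff_eq_zero {d : ℕ} (hd : ∀ w : List ℕ+, d < w.length → f.1.coeff w = 0)
    {u : List X} {v : List Y} (h : d < u.length + v.length) : shuffleCoeff f u v = 0 := by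
  have := shuffleSum_map_congr (F := (eval f : NCQSym (X ⊕ₗ Y)).1)
    (G := (0 : ℚ) • (eval f : NCQSym (X ⊕ₗ Y)).1)
    (l := u.map Sum.inlₗ) (m := v.map Sum.inrₗ) (f := id) (g := id) (fun w hw => by
      rw [map_smul, zero_smul, coeff_eval]
      exact hd _ (by simpa [hw.length_eq] using h))
  rw [shuffleSum_smul, zero_mul] at this
  simpa [shuffleCoeff] using this

/-- Both sides are the sum over the shuffles of three words. -/
theorem sum_shuffles_shuffleCoeff (f : NCQSym ℕ+) (u v w : List ℕ+) :
    ∑ z ∈ shuffles u v, shuffleCoeff f (z.map (letterRank z)) w =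
      ∑ z ∈ shuffles v w, shuffleCoeff f u (z.map (letterRank z)) := by
  -- Both sides are transported to the single alphabet `x < y < z`, where `shuffleSum_assoc`
  -- applies.
  let φ : (ℕ+ ⊕ₗ ℕ+) ⊕ₗ ℕ+ → ℕ+ ⊕ₗ (ℕ+ ⊕ₗ ℕ+) := OrderIso.sumLexAssoc ℕ+ ℕ+ ℕ+
  have hφ : StrictMono φ := (OrderIso.sumLexAssoc ℕ+ ℕ+ ℕ+).strictMono
  let F := (eval f : NCQSym (ℕ+ ⊕ₗ (ℕ+ ⊕ₗ ℕ+))).1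
  let U := u.map (Sum.inlₗ : ℕ+ → ℕ+ ⊕ₗ (ℕ+ ⊕ₗ ℕ+))
  let V := v.map fun y => (Sum.inrₗ (Sum.inlₗ y) : ℕ+ ⊕ₗ (ℕ+ ⊕ₗ ℕ+))
  let T := w.map fun y => (Sum.inrₗ (Sum.inrₗ y) : ℕ+ ⊕ₗ (ℕ+ ⊕ₗ ℕ+))
  simp only [shuffleCoeff_letterRank_left, shuffleCoeff_letterRank_right]
  have h1 := sum_shuffles_eq_shuffleSum
    (NCPowerSeries.ofCoeff fun z : List (ℕ+ ⊕ₗ ℕ+) => shuffleCoeff f z w) u v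
  have h2 := sum_shuffles_eq_shuffleSum
    (NCPowerSeries.ofCoeff fun z : List (ℕ+ ⊕ₗ ℕ+) => shuffleCoeff f u z) v w
  simp only [NCPowerSeries.coeff_ofCoeff] at h1 h2
  rw [h1, h2]
  have e1 := shuffleSum_map_congr
    (F := NCPowerSeries.ofCoeff fun z : List (ℕ+ ⊕ₗ ℕ+) => shuffleCoeff f z w)
    (G := NCPowerSeries.ofCoeff fun z => shuffleSum F z T) (f := id)
    (g := fun z => φ (Sum.inlₗ z)) (l := u.map Sum.inlₗ) (m := v.map Sum.inrₗ)
    (fun z _ => by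
      simp only [NCPowerSeries.coeff_ofCoeff, List.map_id]
      exact shuffleCoeff_eq_shuffleSum f hφ z w)
  have e2 := shuffleSum_map_congr
    (F := NCPowerSeries.ofCoeff fun z : List (ℕ+ ⊕ₗ ℕ+) => shuffleCoeff f u z)
    (G := NCPowerSeries.ofCoeff fun z => shuffleSum F U z) (f := id)
    (g := Sum.inrₗ) (l := v.map Sum.inlₗ) (m := w.map Sum.inrₗ)
    (fun z _ => by
      simp only [NCPowerSeries.coeff_ofCoeff, List.map_id]
      rfl)
  rw [List.map_id, List.map_id, List.map_map, List.map_map] at e1 e2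
  rw [e1, e2]
  exact shuffleSum_assoc F U V T

end NCQSym

/-! ### The coproduct of `NCQSym^r` -/

namespace NCQSymRSubalgebra

open NCQSym

variable {r : ℕ}

instance (r : ℕ) : Ring (NCQSymRSubalgebra r) := inferInstance
instance (r : ℕ) : AddCommGroup (NCQSymRSubalgebra r) := inferInstance
instance (r : ℕ) : AddCommMonoid (NCQSymRSubalgebra r) := inferInstance
instance (r : ℕ) : Module ℚ (NCQSymRSubalgebra r) := inferInstance
instance (r : ℕ) : AddCommGroup (NCQSymRSubalgebra r ⊗[ℚ] NCQSymRSubalgebra r) := inferInstance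
instance (r : ℕ) : AddCommMonoid (NCQSymRSubalgebra r ⊗[ℚ] NCQSymRSubalgebra r) := inferInstance
instance (r : ℕ) : Module ℚ (NCQSymRSubalgebra r ⊗[ℚ] NCQSymRSubalgebra r) := inferInstance

theorem isRInvariant (f : NCQSymRSubalgebra r) : IsRInvariant r f.1.1 := f.2

/-- The coefficient functionals. -/
def coeff (w : List ℕ+) : NCQSymRSubalgebra r →ₗ[ℚ] ℚ :=
  NCPowerSeries.coeff w ∘ₗ (NCQSym ℕ+).val.toLinearMap ∘ₗ (NCQSymRSubalgebra r).val.toLinearMap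

theorem coeff_apply (w : List ℕ+) (f : NCQSymRSubalgebra r) : coeff w f = f.1.1.coeff w := rfl

theorem ext_coeff {f g : NCQSymRSubalgebra r} (h : ∀ w, coeff w f = coeff w g) : f = g :=
  Subtype.ext (Subtype.ext (NCPowerSeries.ext h))

/-- The element with given coefficients. -/
def mk (F : NCPowerSeries ℕ+) (d : ℕ) (hF : IsRInvariant r F)
    (hd : ∀ w : List ℕ+, d < w.length → F.coeff w = 0) : NCQSymRSubalgebra r :=
  ⟨⟨F, hF.isNCQuasisymmetric ⟨d, hd⟩⟩, hF⟩

/-- The dominant monomial functions as elements of the subalgebra. -/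
noncomputable def monomial {n : ℕ} (Φ : RSetComposition r n) : NCQSymRSubalgebra r :=
  ⟨rDominantMonomial Φ, isRInvariant_rDominantMonomial Φ⟩

/-- The elements of degree at most `n`. -/
def degreeLE (r n : ℕ) : Submodule ℚ (NCQSymRSubalgebra r) where
  carrier := {f | ∀ w : List ℕ+, n < w.length → coeff w f = 0}
  add_mem' := fun hf hg w hw => by rw [map_add, hf w hw, hg w hw, add_zero]
  zero_mem' := fun w _ => map_zero _
  smul_mem' := fun c f hf w hw => by rw [map_smul, hf w hw, smul_zero]

theorem exists_mem_degreeLE (f : NCQSymRSubalgebra r) : ∃ n, f ∈ degreeLE r n := f.1.2.1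

/-- The coefficient functionals on tensors. -/
noncomputable def coeff₂ (u v : List ℕ+) : NCQSymRSubalgebra r ⊗[ℚ] NCQSymRSubalgebra r →ₗ[ℚ] ℚ :=
  LinearMap.mul' ℚ ℚ ∘ₗ TensorProduct.map (coeff u) (coeff v)

@[simp] theorem coeff₂_tmul (u v : List ℕ+) (f g : NCQSymRSubalgebra r) :
    coeff₂ u v (f ⊗ₜ[ℚ] g) = coeff u f * coeff v g := rfl

theorem ext_coeff₂ {s t : NCQSymRSubalgebra r ⊗[ℚ] NCQSymRSubalgebra r}
    (h : ∀ u v, coeff₂ u v s = coeff₂ u v t) : s = t :=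
  tensorProduct_eq_of_forall_functionals (fun _ _ => ext_coeff) (fun _ _ => ext_coeff) h

/-- The coefficient functionals on triple tensors. -/
noncomputable def coeff₃ (u v w : List ℕ+) :
    NCQSymRSubalgebra r ⊗[ℚ] (NCQSymRSubalgebra r ⊗[ℚ] NCQSymRSubalgebra r) →ₗ[ℚ] ℚ :=
  LinearMap.mul' ℚ ℚ ∘ₗ TensorProduct.map (coeff u) (coeff₂ v w)

@[simp] theorem coeff₃_tmul (u v w : List ℕ+) (f : NCQSymRSubalgebra r)
    (t : NCQSymRSubalgebra r ⊗[ℚ] NCQSymRSubalgebra r) :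
    coeff₃ u v w (f ⊗ₜ[ℚ] t) = coeff u f * coeff₂ v w t := rfl

theorem ext_coeff₃ {s t : NCQSymRSubalgebra r ⊗[ℚ] (NCQSymRSubalgebra r ⊗[ℚ] NCQSymRSubalgebra r)}
    (h : ∀ u v w, coeff₃ u v w s = coeff₃ u v w t) : s = t :=
  tensorProduct_eq_of_forall_functionals (ψ := fun p : List ℕ+ × List ℕ+ => coeff₂ p.1 p.2)
    (fun _ _ => ext_coeff) (fun _ _ h => ext_coeff₂ fun u v => h (u, v)) fun u p => h u p.1 p.2

theorem coeff_mul (w : List ℕ+) (f g : NCQSymRSubalgebra r) : coeff w (f * g) =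
    ∑ k ∈ Finset.range (w.length + 1), coeff (w.take k) f * coeff (w.drop k) g := rfl

theorem coeff_one (w : List ℕ+) :
    coeff w (1 : NCQSymRSubalgebra r) = if w = [] then 1 else 0 := rfl

theorem coeff₂_mul (u v : List ℕ+) (s t : NCQSymRSubalgebra r ⊗[ℚ] NCQSymRSubalgebra r) :
    coeff₂ u v (s * t) =
      ∑ i ∈ Finset.range (u.length + 1), ∑ j ∈ Finset.range (v.length + 1),
        coeff₂ (u.take i) (v.take j) s * coeff₂ (u.drop i) (v.drop j) t := by
  induction s with
  | zero => simp
  | add s s' hs hs' => simp only [_root_.add_mul, map_add, hs, hs', Finset.sum_add_distrib]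
  | tmul a b =>
    induction t with
    | zero => simp
    | add t t' ht ht' => simp only [_root_.mul_add, map_add, ht, ht', Finset.sum_add_distrib]
    | tmul c d =>
      simp only [Algebra.TensorProduct.tmul_mul_tmul, coeff₂_tmul, coeff_mul, Finset.sum_mul_sum]
      exact Finset.sum_congr rfl fun i _ => Finset.sum_congr rfl fun j _ => by ring

/-- The coproduct of `NCQSym` restricts to `NCQSym^r`, compatibly with degrees. -/
theorem exists_coproduct (f : NCQSymRSubalgebra r) {d : ℕ} (hf : f ∈ degreeLE r d) :
    ∃ t ∈ tensorFiltration (degreeLE r) d, ∀ u v, coeff₂ u v t = shuffleCoeff f.1 u v := by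
  have hd : ∀ w : List ℕ+, d < w.length → f.1.1.coeff w = 0 := hf
  -- For fixed `u`, the coefficients as a series in the second word: invariant, of degree at most `d
  -- - u.length`. Truncation of the subtraction is harmless, since a nonempty `v` still exceeds
  -- total degree `d`.
  let G : List ℕ+ → NCPowerSeries ℕ+ := fun u => .ofCoeff fun v => shuffleCoeff f.1 u v
  have hGd : ∀ u v : List ℕ+, d - u.length < v.length → (G u).coeff v = 0 := fun u v h =>
    shuffleCoeff_eq_zero hd (by omega)
  let g : List ℕ+ → NCQSymRSubalgebra r := fun u => mk (G u) (d - u.length)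
    (fun Z l a b H => by
      simpa [G] using shuffleCoeff_map_eq (isRInvariant f) (RSimilar.refl r u id) H) (hGd u)
  -- Expansion in the first word, whose coefficients are the series `g`. A monomial of degree `n ≤
  -- d` is paired with degree at most `d - n`, as the filtration requires.
  refine ⟨∑ n ∈ Finset.range (d + 1), ∑ c : Quotient (rSimilarSetoid r n),
    monomial (RSetComposition.ofTuple r c.out) ⊗ₜ[ℚ] g (List.ofFn c.out), ?_, fun u v => ?_⟩
  · refine Submodule.sum_mem _ fun n hn => Submodule.sum_mem _ fun c _ => Submodule.subset_span ?_
    refine ⟨n, d - n, by simp at hn; omega, _, fun w hw => ?_, _, fun w hw => ?_, rfl⟩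
    · exact coeff_rDominantMonomial_of_length_ne _ hw.ne'
    · exact hGd _ w (by simpa using hw)
  · have hv : IsRInvariant r (NCPowerSeries.ofCoeff fun u : List ℕ+ => shuffleCoeff f.1 u v) :=
      fun Z l a b H => by
        simpa using shuffleCoeff_map_eq (isRInvariant f) H (RSimilar.refl r v id)
    have := hv.coeff_eq_sum_sum (d := d) (fun w hw => shuffleCoeff_eq_zero hd (by omega)) u
    rw [NCPowerSeries.coeff_ofCoeff] at this
    rw [this]
    simp only [map_sum, coeff₂_tmul]
    exact Finset.sum_congr rfl fun n _ => Finset.sum_congr rfl fun c _ => mul_comm _ _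

theorem exists_coeff₂_eq (f : NCQSymRSubalgebra r) :
    ∃ t : NCQSymRSubalgebra r ⊗[ℚ] NCQSymRSubalgebra r,
      ∀ u v, coeff₂ u v t = shuffleCoeff f.1 u v := by
  obtain ⟨d, hd⟩ := exists_mem_degreeLE f
  obtain ⟨t, -, ht⟩ := exists_coproduct f hd
  exact ⟨t, ht⟩

/-- The coproduct of `NCQSym^r` as a linear map. -/
noncomputable def comulLinear (r : ℕ) :
    NCQSymRSubalgebra r →ₗ[ℚ] NCQSymRSubalgebra r ⊗[ℚ] NCQSymRSubalgebra r where
  -- The choice is forced, because coefficients determine a tensor; linearity follows in the same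
  -- way.
  toFun := fun f => (exists_coeff₂_eq f).choose
  map_add' := fun f g => ext_coeff₂ fun u v => by
    rw [map_add, (exists_coeff₂_eq (f + g)).choose_spec, (exists_coeff₂_eq f).choose_spec,
      (exists_coeff₂_eq g).choose_spec, ← shuffleCoeff_add]
    rfl
  map_smul' := fun c f => ext_coeff₂ fun u v => by
    rw [RingHom.id_apply, map_smul, (exists_coeff₂_eq (c • f)).choose_spec,
      (exists_coeff₂_eq f).choose_spec, smul_eq_mul, ← shuffleCoeff_smul]
    rfl

theorem coeff₂_comulLinear (u v : List ℕ+) (f : NCQSymRSubalgebra r) :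
    coeff₂ u v (comulLinear r f) = shuffleCoeff f.1 u v := (exists_coeff₂_eq f).choose_spec u v

theorem comulLinear_mem_tensorFiltration (n : ℕ) (f : NCQSymRSubalgebra r)
    (hf : f ∈ degreeLE r n) : comulLinear r f ∈ tensorFiltration (degreeLE r) n := by
  obtain ⟨t, ht, h⟩ := exists_coproduct f hf
  rwa [show comulLinear r f = t from ext_coeff₂ fun u v => by rw [coeff₂_comulLinear, h]]

/-- The coproduct of `NCQSym^r` as an algebra homomorphism. -/
noncomputable def comul (r : ℕ) :
    NCQSymRSubalgebra r →ₐ[ℚ] NCQSymRSubalgebra r ⊗[ℚ] NCQSymRSubalgebra r :=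
  AlgHom.ofLinearMap (comulLinear r)
    (ext_coeff₂ fun u v => by
      rw [coeff₂_comulLinear, Algebra.TensorProduct.one_def, coeff₂_tmul, coeff_one, coeff_one]
      exact shuffleCoeff_one u v)
    (fun f g => ext_coeff₂ fun u v => by
      simp only [coeff₂_mul, coeff₂_comulLinear]
      exact shuffleCoeff_mul f.1 g.1 u v)

theorem coeff₂_comul (u v : List ℕ+) (f : NCQSymRSubalgebra r) :
    coeff₂ u v (comul r f) = shuffleCoeff f.1 u v := coeff₂_comulLinear u v f

/-- The counit of `NCQSym^r`: the constant coefficient. -/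
noncomputable def counit (r : ℕ) : NCQSymRSubalgebra r →ₐ[ℚ] ℚ :=
  AlgHom.ofLinearMap (coeff []) (by simp [coeff_one]) (fun f g => by simp [coeff_mul])

theorem coeff₂_comul_eq_sum (u v : List ℕ+) (f : NCQSymRSubalgebra r) :
    coeff₂ u v (comul r f) = ∑ z ∈ shuffles u v, coeff (z.map (letterRank z)) f := by
  rw [coeff₂_comul, ← coeffBar_eq_shuffleCoeff]
  rfl

theorem coeff₂_sum_left {ι : Type} (S : Finset ι) (φ : ι → List ℕ+) (w : List ℕ+)
    (t : NCQSymRSubalgebra r ⊗[ℚ] NCQSymRSubalgebra r) :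
    LinearMap.mul' ℚ ℚ (TensorProduct.map (∑ z ∈ S, coeff (φ z)) (coeff w) t) =
      ∑ z ∈ S, coeff₂ (φ z) w t := by
  induction t with
  | zero => simp
  | add s s' hs hs' => simp only [map_add, hs, hs', Finset.sum_add_distrib]
  | tmul a b => simp [Finset.sum_mul]

theorem coeff₂_sum_right {ι : Type} (S : Finset ι) (φ : ι → List ℕ+) (u : List ℕ+)
    (t : NCQSymRSubalgebra r ⊗[ℚ] NCQSymRSubalgebra r) :
    LinearMap.mul' ℚ ℚ (TensorProduct.map (coeff u) (∑ z ∈ S, coeff (φ z)) t) =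
      ∑ z ∈ S, coeff₂ u (φ z) t := by
  induction t with
  | zero => simp
  | add s s' hs hs' => simp only [map_add, hs, hs', Finset.sum_add_distrib]
  | tmul a b => simp [Finset.mul_sum]

/-- The coproduct pulls coefficient functionals back to sums of coefficient functionals, so iterated
coproducts can be evaluated one tensor factor at a time. -/
theorem coeff₂_comp_comul (u v : List ℕ+) :
    coeff₂ u v ∘ₗ (comul r).toLinearMap =
      ∑ z ∈ shuffles u v, coeff (r := r) (z.map (letterRank z)) :=
  LinearMap.ext fun f => by
    rw [LinearMap.sum_apply]
    exact coeff₂_comul_eq_sum u v f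

theorem coeff₃_assoc_map_comul (u v w : List ℕ+)
    (t : NCQSymRSubalgebra r ⊗[ℚ] NCQSymRSubalgebra r) :
    coeff₃ u v w (TensorProduct.assoc ℚ _ _ _
      (TensorProduct.map (comul r).toLinearMap LinearMap.id t)) =
      ∑ z ∈ shuffles u v, coeff₂ (z.map (letterRank z)) w t := by
  rw [← coeff₂_sum_left, ← coeff₂_comp_comul]
  exact mul'_map_assoc_map_id _ _ _ _ t

theorem coeff₃_map_comul (u v w : List ℕ+) (t : NCQSymRSubalgebra r ⊗[ℚ] NCQSymRSubalgebra r) :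
    coeff₃ u v w (TensorProduct.map LinearMap.id (comul r).toLinearMap t) =
      ∑ z ∈ shuffles v w, coeff₂ u (z.map (letterRank z)) t := by
  rw [← coeff₂_sum_right, ← coeff₂_comp_comul]
  exact congrArg (LinearMap.mul' ℚ ℚ) (TensorProduct.map_map _ _ _ _ t)

theorem coeff_lid_map_counit (w : List ℕ+) (t : NCQSymRSubalgebra r ⊗[ℚ] NCQSymRSubalgebra r) :
    coeff w (TensorProduct.lid ℚ _ (TensorProduct.map (counit r).toLinearMap LinearMap.id t)) =
      coeff₂ [] w t :=
  functional_lid_map_id _ _ t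

theorem coeff_rid_map_counit (w : List ℕ+) (t : NCQSymRSubalgebra r ⊗[ℚ] NCQSymRSubalgebra r) :
    coeff w (TensorProduct.rid ℚ _ (TensorProduct.map LinearMap.id (counit r).toLinearMap t)) =
      coeff₂ w [] t :=
  functional_rid_map_id _ _ t

/-- The bialgebra structure of `NCQSym^r`. -/
noncomputable instance bialgebra (r : ℕ) : Bialgebra ℚ (NCQSymRSubalgebra r) :=
  Bialgebra.ofAlgHom (comul r) (counit r)
    (AlgHom.ext fun f => ext_coeff₃ fun u v w => by
      refine (coeff₃_assoc_map_comul u v w (comul r f)).trans ?_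
      refine Eq.trans ?_ (coeff₃_map_comul u v w (comul r f)).symm
      simp only [coeff₂_comul]
      -- Both iterated coproducts sum over the shuffles of `u`, `v` and `w`.
      exact sum_shuffles_shuffleCoeff f.1 u v w)
    (AlgHom.ext fun f => (TensorProduct.lid ℚ _).injective (ext_coeff fun w => by
      refine (coeff_lid_map_counit w (comul r f)).trans ?_
      rw [coeff₂_comul, shuffleCoeff_nil_left]
      simp [coeff_apply]))
    (AlgHom.ext fun f => (TensorProduct.rid ℚ _).injective (ext_coeff fun w => by
      refine (coeff_rid_map_counit w (comul r f)).trans ?_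
      rw [coeff₂_comul, shuffleCoeff_nil_right]
      simp [coeff_apply]))

theorem algebraMap_counit_of_mem_degreeLE_zero (f : NCQSymRSubalgebra r) (hf : f ∈ degreeLE r 0) :
    algebraMap ℚ (NCQSymRSubalgebra r) (Coalgebra.counit f) = f := by
  refine ext_coeff fun w => ?_
  rw [Algebra.algebraMap_eq_smul_one, map_smul, coeff_one]
  cases w with
  | nil => exact mul_one _
  | cons a w => rw [if_neg (by simp), smul_zero, hf _ (by simp)]

theorem coeffTensor_map_val (u v : List ℕ+) (t : NCQSymRSubalgebra r ⊗[ℚ] NCQSymRSubalgebra r) :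
    coeffTensor u v (TensorProduct.map (NCQSymRSubalgebra r).val.toLinearMap
      (NCQSymRSubalgebra r).val.toLinearMap t) = coeff₂ u v t := by
  induction t with
  | zero => simp
  | add s s' hs hs' => simp only [map_add, hs, hs']
  | tmul a b => rfl

end NCQSymRSubalgebra

/-- The condition `InheritsFromNCQSym`, for bialgebras. -/
def BialgebraInheritsFromNCQSym {H : Type} [Semiring H] [Bialgebra ℚ H] (ι : H → NCQSym ℕ+) : Prop :=
  Function.Injective ι ∧ ∃ φ : H →ₐ[ℚ] NCQSym ℕ+, ⇑φ = ι ∧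
    ∀ h : H, NCQSym.IsCoproduct (ι h)
      (TensorProduct.map φ.toLinearMap φ.toLinearMap (Coalgebra.comul (R := ℚ) h))

theorem bialgebraInheritsFromNCQSym_val (r : ℕ) :
    BialgebraInheritsFromNCQSym (Subtype.val : NCQSymRSubalgebra r → NCQSym ℕ+) := by
  refine ⟨Subtype.val_injective, (NCQSymRSubalgebra r).val, rfl, fun f u v => ?_⟩
  refine (NCQSymRSubalgebra.coeffTensor_map_val u v (NCQSymRSubalgebra.comul r f)).trans ?_
  rw [NCQSymRSubalgebra.coeff₂_comul, NCQSym.coeffBar_eq_shuffleCoeff]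

open NCQSymRSubalgebra in
theorem mainTheorem2 (r : ℕ) (hr : 0 < r) :
    ∃ (A : Subalgebra ℚ (NCQSym ℕ+)) (_ : HopfAlgebra ℚ A),
      Subalgebra.toSubmodule A = NCQSymR r ∧
      InheritsFromNCQSym (Subtype.val : A → NCQSym ℕ+) := by
  obtain ⟨K, hK⟩ := exists_hopfAlgebra_of_filtration (R := ℚ) (degreeLE r) exists_mem_degreeLE
    algebraMap_counit_of_mem_degreeLE_zero comulLinear_mem_tensorFiltration
  refine ⟨NCQSymRSubalgebra r, K, toSubmodule_NCQSymRSubalgebra r, ?_⟩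
  have h := bialgebraInheritsFromNCQSym_val r
  -- The claim depends on `K` only through its bialgebra structure, which `hK` identifies with the
  -- one constructed above.
  rw [← hK] at h
  exact h
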